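/- Let $C_0(\mathbb R\cup\{+\infty\})$ be the continuous complex functions on $(-\infty,+\infty]$ vanishing at $-\infty$, acting on $L^2(\mathbb R)$ by multiplication operators $M(f)$. Let $\lambda$ be the regular representation of $\mathbb R$ on $L^2(\mathbb R)$, $(\lambda_t\xi)(x)=\xi(x-t)$, and also its integrated form, a representation of the group C*-algebra $C^*(\mathbb R)$ given on $L^1(\mathbb R)\subset C^*(\mathbb R)$ by convolution, $\lambda(g)\xi=g*\xi$. (Thus $\lambda(C^*(\mathbb R))$ is the norm closure of $\lambda(L^1(\mathbb R))$.) The Wiener–Hopf algebra $\mathcal T_{\mathbb R}$ is the C*-algebra on $L^2(\mathbb R)$ generated by all products $M(f)\lambda(g)$ with $f\in C_0(\mathbb R\cup\{+\infty\})$ and $g\in C^*(\mathbb R)$. Let $u$ be an orientation-preserving smooth diffeomorphism of $\mathbb R$ with $\lim_{x\to+\infty}u'(x)=+\infty$. Let $U:L^2(\mathbb R)\to L^2(\mathbb R)$ be the corresponding Hilbert space isomorphism, $(U\xi)(x)=u'(x)^{1/2}\,\xi(u(x))$, and write $\mathrm{Ad}_U(T)=UTU^{-1}$. Then $\mathcal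 T_{\mathbb R}$ is not preserved by $\mathrm{Ad}_U$, that is, $\mathrm{Ad}_U(\mathcal T_{\mathbb R})\not\subseteq\mathcal T_{\mathbb R}$. Moreover, $$\mathcal T_{\mathbb R}\cap \mathrm{Ad}_U(\mathcal T_{\mathbb R})=\mathcal K(L^2(\mathbb R)),$$ the set of all compact operators on $L^2(\mathbb R)$. -/

import Mathlib

open MeasureTheory Filter Topology
open scoped ContDiff Manifold ZeroAtInfty

noncomputable section

namespace WienerHopf

/-- The Hilbert space `L²(ℝ)` of complex-valued functions, with Lebesgue measure. -/
abbrev L2R : Type := Lp ℂ 2 (volume : Measure ℝ)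

/-! ### The multiplication representation of `C₀(ℝ ∪ {+∞})` -/

/-- The one-sided extension `(-∞, +∞]` of the real line, with its order topology. -/
abbrev ExtLine : Type := Set.Ioi (⊥ : EReal)

/-- The inclusion of the real line into `(-∞, +∞]`. -/
def toExtLine (x : ℝ) : ExtLine := ⟨(x : EReal), EReal.bot_lt_coe x⟩

theorem continuous_toExtLine : Continuous toExtLine :=
  Continuous.subtype_mk continuous_coe_real_ereal _

theorem memLp_restrict (f : C₀(ExtLine, ℂ)) :
    MemLp (fun x : ℝ => f (toExtLine x)) ⊤ (volume : Measure ℝ) := by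
  refine memLp_top_of_bound
    ((map_continuous f).comp continuous_toExtLine).aestronglyMeasurable ‖f.toBCF‖ ?_
  exact Eventually.of_forall fun x => f.toBCF.norm_coe_le_norm (toExtLine x)

/-- `M(f)`: multiplication by (the restriction to `ℝ` of) `f ∈ C₀(ℝ ∪ {+∞})` on `L²(ℝ)`. -/
def mulRep (f : C₀(ExtLine, ℂ)) : L2R →L[ℂ] L2R :=
  (ContinuousLinearMap.mul ℂ ℂ).holderL volume ⊤ 2 2 (memLp_restrict f).toLp

theorem mulRep_coeFn (f : C₀(ExtLine, ℂ)) (ξ : L2R) :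
    mulRep f ξ =ᵐ[volume] fun x => f (toExtLine x) * ξ x := by
  have h1 := (ContinuousLinearMap.mul ℂ ℂ).coeFn_holder (r := 2) (memLp_restrict f).toLp ξ
  have h2 := (memLp_restrict f).coeFn_toLp
  filter_upwards [h1, h2] with x hx1 hx2
  rw [mulRep, ContinuousLinearMap.holderL_apply_apply, hx1, hx2]
  rfl

/-! ### The regular representation of `ℝ` and its integrated form -/

/-- The regular representation of the group `ℝ` on `L²(ℝ)`: `(λ_t ξ)(x) = ξ(x - t)`. -/
def translation (t : ℝ) : L2R →ₗᵢ[ℂ] L2R :=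
  Lp.compMeasurePreservingₗᵢ ℂ (fun x : ℝ => x - t) (measurePreserving_sub_right volume t)

theorem translation_coeFn (t : ℝ) (ξ : L2R) :
    translation t ξ =ᵐ[volume] fun x => ξ (x - t) :=
  Lp.coeFn_compMeasurePreserving ξ (measurePreserving_sub_right volume t)

theorem continuous_translation (ξ : L2R) : Continuous fun t : ℝ => translation t ξ := by
  let g : ℝ → C(ℝ, ℝ) := fun t => ⟨fun x => x - t, by fun_prop⟩
  have hg : Continuous g := by
    refine ContinuousMap.continuous_of_continuous_uncurry _ ?_
    change Continuous fun p : ℝ × ℝ => p.2 - p.1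
    fun_prop
  exact (continuous_const (y := ξ)).compMeasurePreservingLp hg
    (fun t => measurePreserving_sub_right volume t) (by simp)

theorem integrable_smul_translation (g : Lp ℂ 1 (volume : Measure ℝ)) (ξ : L2R) :
    Integrable (fun t : ℝ => g t • translation t ξ) volume := by
  refine ((L1.integrable_coeFn g).norm.mul_const ‖ξ‖).mono'
    ((Lp.aestronglyMeasurable g).smul (continuous_translation ξ).aestronglyMeasurable) ?_
  refine Eventually.of_forall fun t => ?_
  simp [norm_smul]

/-- The integrated form of the regular representation on `L¹(ℝ)`, that is, convolution:
`λ(g) ξ = g * ξ = ∫ g(t) λ_t ξ dt`, an absolutely convergent integral in `L²(ℝ)`. -/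
def convRep (g : Lp ℂ 1 (volume : Measure ℝ)) : L2R →L[ℂ] L2R :=
  LinearMap.mkContinuous
    { toFun := fun ξ => ∫ t : ℝ, g t • translation t ξ
      map_add' := fun ξ η => by
        rw [← integral_add (integrable_smul_translation g ξ) (integrable_smul_translation g η)]
        simp only [map_add, smul_add]
      map_smul' := fun c ξ => by
        rw [RingHom.id_apply, ← integral_smul]
        simp only [map_smul, smul_comm c] }
    ‖g‖ (fun ξ => by
      refine (norm_integral_le_integral_norm _).trans (le_of_eq ?_)
      simp only [norm_smul, LinearIsometry.norm_map, integral_mul_const, L1.norm_eq_integral_norm])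

/-- `λ(C*(ℝ))`: the concrete group C⋆-algebra of `ℝ`, the norm closure in `B(L²(ℝ))` of the
algebra of convolution operators by integrable functions. -/
def groupCStar : NonUnitalStarSubalgebra ℂ (L2R →L[ℂ] L2R) :=
  (NonUnitalStarAlgebra.adjoin ℂ (Set.range convRep)).topologicalClosure

/-- The Wiener–Hopf algebra `T_ℝ`: the C⋆-subalgebra of `B(L²(ℝ))` generated by the products
`M(f) λ(g)` with `f ∈ C₀(ℝ ∪ {+∞})` and `g ∈ C*(ℝ)`. -/
def wienerHopf : NonUnitalStarSubalgebra ℂ (L2R →L[ℂ] L2R) :=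
  (NonUnitalStarAlgebra.adjoin ℂ
    {T | ∃ f : C₀(ExtLine, ℂ), ∃ G ∈ groupCStar, T = mulRep f * G}).topologicalClosure

/-! ### The unitary induced by an orientation-preserving diffeomorphism -/

/-- Smooth diffeomorphisms of the real line. -/
abbrev DiffeoR : Type := Diffeomorph 𝓘(ℝ, ℝ) 𝓘(ℝ, ℝ) ℝ ℝ ∞

/-- `u` preserves the orientation of `ℝ`. -/
def OrientationPreserving (u : DiffeoR) : Prop := ∀ x : ℝ, 0 < deriv u x

theorem hasDerivAt (u : DiffeoR) (x : ℝ) : HasDerivAt u (deriv u x) x :=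
  ((u.contMDiff.contDiff.differentiable (by simp)) x).hasDerivAt

theorem deriv_mul_deriv_symm (u : DiffeoR) (x : ℝ) : deriv u x * deriv u.symm (u x) = 1 := by
  have h := (hasDerivAt u.symm (u x)).comp x (hasDerivAt u x)
  have h2 : (⇑u.symm ∘ ⇑u) = id := funext fun y => u.symm_apply_apply y
  rw [h2] at h
  rw [mul_comm]
  exact h.unique (hasDerivAt_id x)

theorem OrientationPreserving.symm {u : DiffeoR} (hu : OrientationPreserving u) :
    OrientationPreserving u.symm := fun y => by
  have h := deriv_mul_deriv_symm u (u.symm y)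
  rw [u.apply_symm_apply] at h
  have := hu (u.symm y)
  by_contra hc
  nlinarith [not_lt.mp hc]

theorem lintegral_comp_diffeo {u : DiffeoR} (hu : OrientationPreserving u) (g : ℝ → ENNReal) :
    ∫⁻ x, ENNReal.ofReal (deriv u x) * g (u x) = ∫⁻ y, g y := by
  have hs : Function.Surjective (⇑u) := u.surjective
  have h := lintegral_image_eq_lintegral_abs_deriv_mul (f := u) (f' := deriv u) MeasurableSet.univ
    (fun x _ => (hasDerivAt u x).hasDerivWithinAt) u.injective.injOn g
  rw [Set.image_univ, hs.range_eq] at h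
  simp only [Measure.restrict_univ] at h
  rw [h]
  simp only [abs_of_pos (hu _)]

theorem quasiMeasurePreserving {u : DiffeoR} (hu : OrientationPreserving u) :
    Measure.QuasiMeasurePreserving u (volume : Measure ℝ) volume := by
  refine ⟨u.continuous.measurable, Measure.AbsolutelyContinuous.mk fun s hs h0 => ?_⟩
  rw [Measure.map_apply u.continuous.measurable hs]
  have h1 := lintegral_comp_diffeo hu (s.indicator 1)
  rw [lintegral_indicator_one hs, h0, lintegral_eq_zero_iff] at h1
  · refine measure_mono_null (fun x hx => ?_) (ae_iff.mp h1)
    have hx' : u x ∈ s := hx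
    simp [hx', hu x]
  · exact ((measurable_deriv _).ennreal_ofReal).mul
      ((measurable_one.indicator hs).comp u.continuous.measurable)

theorem eLpNorm_weighted {u : DiffeoR} (hu : OrientationPreserving u) (ξ : ℝ → ℂ) :
    eLpNorm (fun x => ((Real.sqrt (deriv u x) : ℝ) : ℂ) * ξ (u x)) 2 (volume : Measure ℝ) =
      eLpNorm ξ 2 volume := by
  rw [eLpNorm_eq_lintegral_rpow_enorm_toReal (by norm_num) (by norm_num),
    eLpNorm_eq_lintegral_rpow_enorm_toReal (by norm_num) (by norm_num)]
  congr 1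
  rw [← lintegral_comp_diffeo hu (fun y => ‖ξ y‖ₑ ^ (2 : ENNReal).toReal)]
  refine lintegral_congr fun x => ?_
  rw [enorm_mul, ENNReal.mul_rpow_of_nonneg _ _ (by norm_num)]
  congr 1
  rw [← ofReal_norm, Complex.norm_real, Real.norm_of_nonneg (Real.sqrt_nonneg _),
    ENNReal.ofReal_rpow_of_nonneg (Real.sqrt_nonneg _) (by norm_num)]
  simp [Real.sq_sqrt (hu x).le]

theorem memLp_weighted {u : DiffeoR} (hu : OrientationPreserving u) (ξ : L2R) :
    MemLp (fun x => ((Real.sqrt (deriv u x) : ℝ) : ℂ) * ξ (u x)) 2 (volume : Measure ℝ) := by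
  refine ⟨?_, ?_⟩
  · refine AEStronglyMeasurable.mul ?_
      ((Lp.aestronglyMeasurable ξ).comp_quasiMeasurePreserving (quasiMeasurePreserving hu))
    exact (Complex.measurable_ofReal.comp
      (Real.continuous_sqrt.measurable.comp (measurable_deriv _))).aestronglyMeasurable
  · rw [eLpNorm_weighted hu]
    exact Lp.eLpNorm_lt_top ξ

/-- `ξ ↦ (u')^{1/2} · (ξ ∘ u)` on `L²(ℝ)`. -/
def pullback {u : DiffeoR} (hu : OrientationPreserving u) (ξ : L2R) : L2R :=
  (memLp_weighted hu ξ).toLp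

theorem pullback_coeFn {u : DiffeoR} (hu : OrientationPreserving u) (ξ : L2R) :
    pullback hu ξ =ᵐ[volume] fun x => ((Real.sqrt (deriv u x) : ℝ) : ℂ) * ξ (u x) :=
  (memLp_weighted hu ξ).coeFn_toLp

theorem pullback_symm_pullback {u v : DiffeoR} (hu : OrientationPreserving u)
    (hv : OrientationPreserving v) (huv : ∀ x, v (u x) = x)
    (hd : ∀ x, deriv u x * deriv v (u x) = 1) (ξ : L2R) :
    pullback hu (pullback hv ξ) = ξ := by
  refine Lp.ext ?_
  filter_upwards [pullback_coeFn hu (pullback hv ξ),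
    (quasiMeasurePreserving hu).ae (pullback_coeFn hv ξ)] with x h1 h2
  rw [h1, h2, huv, ← mul_assoc, ← Complex.ofReal_mul, ← Real.sqrt_mul (hu x).le, hd]
  simp

/-- The unitary operator `U` of `L²(ℝ)` induced by an orientation-preserving diffeomorphism `u`:
`(U ξ)(x) = u'(x)^{1/2} ξ(u(x))`. -/
def diffeoUnitary (u : DiffeoR) (hu : OrientationPreserving u) : L2R ≃ₗᵢ[ℂ] L2R where
  toFun := pullback hu
  invFun := pullback hu.symm
  map_add' ξ η := by
    refine Lp.ext ?_
    filter_upwards [pullback_coeFn hu (ξ + η), Lp.coeFn_add (pullback hu ξ) (pullback hu η),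
      pullback_coeFn hu ξ, pullback_coeFn hu η,
      (quasiMeasurePreserving hu).ae (Lp.coeFn_add ξ η)] with x h1 h2 h3 h4 h5
    rw [h1, h2, Pi.add_apply, h3, h4, h5, Pi.add_apply, mul_add]
  map_smul' c ξ := by
    refine Lp.ext ?_
    filter_upwards [pullback_coeFn hu (c • ξ), Lp.coeFn_smul c (pullback hu ξ),
      pullback_coeFn hu ξ, (quasiMeasurePreserving hu).ae (Lp.coeFn_smul c ξ)] with x h1 h2 h3 h4
    rw [RingHom.id_apply, h1, h2, Pi.smul_apply, h3, h4, Pi.smul_apply, smul_eq_mul, smul_eq_mul,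
      mul_left_comm]
  left_inv ξ := by
    refine pullback_symm_pullback hu.symm hu u.apply_symm_apply (fun y => ?_) ξ
    have h := deriv_mul_deriv_symm u (u.symm y)
    rwa [u.apply_symm_apply, mul_comm] at h
  right_inv ξ :=
    pullback_symm_pullback hu hu.symm u.symm_apply_apply (deriv_mul_deriv_symm u) ξ
  norm_map' ξ := by
    change ‖(memLp_weighted hu ξ).toLp‖ = ‖ξ‖
    rw [Lp.norm_toLp, eLpNorm_weighted hu, Lp.norm_def]

theorem diffeoUnitary_coeFn (u : DiffeoR) (hu : OrientationPreserving u) (ξ : L2R) :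
    diffeoUnitary u hu ξ =ᵐ[volume] fun x => ((Real.sqrt (deriv u x) : ℝ) : ℂ) * ξ (u x) :=
  pullback_coeFn hu ξ

/-- `Ad_U(A) = U A U⁻¹` for a `⋆`-subalgebra `A` of `B(L²(ℝ))` and a unitary operator `U`. -/
def adImage (U : L2R ≃ₗᵢ[ℂ] L2R) (A : NonUnitalStarSubalgebra ℂ (L2R →L[ℂ] L2R)) :
    NonUnitalStarSubalgebra ℂ (L2R →L[ℂ] L2R) :=
  A.map U.conjStarAlgEquiv

end WienerHopf

end

/-! Modulo compact operators, an element T of the Wiener–Hopf algebra is determined by its behaviour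
near +∞: T is congruent to M(χ)G for a unique G in λ(C*(ℝ)), its symbol, where χ is a cutoff rising
from 0 to 1 (`wienerHopf_le_asymptoticConv`). Conjugating by translations towards +∞ kills compact
operators weakly and turns χ into 1. Hence ‖G‖ ≤ ‖T‖ (`norm_le_of_isCompactOperator_sub`), which
gives uniqueness and shows that the operators with a symbol form a closed set. They form a ⋆-algebra
because M(f)G is compact when f vanishes at both ends, and M(χ)[M(ψ), G] is compact when ψ varies
slowly at +∞.

Let T = USU⁻¹ with S and T both in the algebra. Since u' → +∞, the inverse of u has derivative
tending to 0 at +∞, so the function exp(2πis u⁻¹(x)) varies slowly there and commutes with S modulo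
compacts. Conjugation by U turns it into the character exp(2πisx), which therefore commutes with T
modulo compacts, for every s. By uniqueness G is invariant under conjugation by all characters. On
the Fourier side this is translation, and a translation-invariant function vanishing at infinity is
0; here this is the Riemann–Lebesgue lemma `tendsto_modulate_apply`. So G = 0 and T is compact
(`isCompactOperator_of_mem_inf`).

Conversely, the algebra contains every rank-one operator, hence every compact operator, and
compactness is invariant under Ad_U. Since the algebra also contains a noncompact operator, it
cannot contain its own image under Ad_U: that image would lie in the intersection and consist of
compact operators. -/

noncomputable section

namespace WienerHopf

/-! ### Multiplication operators by bounded measurable functions -/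

/-- Bounded measurable functions on the line. -/
structure Bdd (f : ℝ → ℂ) : Prop where
  meas : Measurable f
  bound : ∃ C : ℝ, ∀ x, ‖f x‖ ≤ C

namespace Bdd

variable {f g : ℝ → ℂ}

theorem memLp (h : Bdd f) : MemLp f ⊤ (volume : Measure ℝ) :=
  memLp_top_of_bound h.meas.aestronglyMeasurable h.bound.choose
    (Eventually.of_forall h.bound.choose_spec)

theorem const (c : ℂ) : Bdd (fun _ => c) := ⟨measurable_const, ‖c‖, fun _ => le_rfl⟩

theorem mul (hf : Bdd f) (hg : Bdd g) : Bdd (fun x => f x * g x) := by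
  obtain ⟨C, hC⟩ := hf.bound
  obtain ⟨D, hD⟩ := hg.bound
  refine ⟨hf.meas.mul hg.meas, C * D, fun x => ?_⟩
  rw [norm_mul]
  exact mul_le_mul (hC x) (hD x) (norm_nonneg _) ((norm_nonneg _).trans (hC x))

theorem add (hf : Bdd f) (hg : Bdd g) : Bdd (fun x => f x + g x) := by
  obtain ⟨C, hC⟩ := hf.bound
  obtain ⟨D, hD⟩ := hg.bound
  exact ⟨hf.meas.add hg.meas, C + D, fun x => (norm_add_le _ _).trans (add_le_add (hC x) (hD x))⟩

theorem sub (hf : Bdd f) (hg : Bdd g) : Bdd (fun x => f x - g x) := by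
  obtain ⟨C, hC⟩ := hf.bound
  obtain ⟨D, hD⟩ := hg.bound
  exact ⟨hf.meas.sub hg.meas, C + D, fun x => (norm_sub_le _ _).trans (add_le_add (hC x) (hD x))⟩

theorem conj (hf : Bdd f) : Bdd (fun x => starRingEnd ℂ (f x)) := by
  obtain ⟨C, hC⟩ := hf.bound
  exact ⟨Complex.continuous_conj.measurable.comp hf.meas, C, fun x => by simpa using hC x⟩

theorem comp (hf : Bdd f) {v : ℝ → ℝ} (hv : Measurable v) : Bdd (fun x => f (v x)) :=
  ⟨hf.meas.comp hv, hf.bound.imp fun _ h x => h (v x)⟩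

theorem indicator (hf : Bdd f) {s : Set ℝ} (hs : MeasurableSet s) : Bdd (s.indicator f) := by
  obtain ⟨C, hC⟩ := hf.bound
  exact ⟨hf.meas.indicator hs, C, fun x => (norm_indicator_le_norm_self f x).trans (hC x)⟩

end Bdd

open Classical in
/-- Multiplication by the bounded measurable function `f` on `L²(ℝ)`. -/
def mulOp (f : ℝ → ℂ) : L2R →L[ℂ] L2R :=
  -- The value 0 outside L^∞ makes the operator depend on the bare function alone, so symbols can be
  -- rewritten pointwise and norm bounds need no measurability.
  if h : MemLp f ⊤ (volume : Measure ℝ) then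
    (ContinuousLinearMap.mul ℂ ℂ).holderL volume ⊤ 2 2 h.toLp
  else 0

theorem mulOp_coeFn {f : ℝ → ℂ} (hf : Bdd f) (ξ : L2R) :
    mulOp f ξ =ᵐ[volume] fun x => f x * ξ x := by
  have h1 := (ContinuousLinearMap.mul ℂ ℂ).coeFn_holder (r := 2) hf.memLp.toLp ξ
  filter_upwards [h1, hf.memLp.coeFn_toLp] with x hx1 hx2
  rw [mulOp, dif_pos hf.memLp, ContinuousLinearMap.holderL_apply_apply, hx1, hx2]
  rfl

theorem mulRep_eq_mulOp (f : C₀(ExtLine, ℂ)) : mulRep f = mulOp fun x => f (toExtLine x) := by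
  rw [mulOp, dif_pos (memLp_restrict f), mulRep]

theorem bdd_restrict (f : C₀(ExtLine, ℂ)) : Bdd fun x => f (toExtLine x) :=
  ⟨((map_continuous f).comp continuous_toExtLine).measurable, ‖f.toBCF‖,
    fun x => f.toBCF.norm_coe_le_norm (toExtLine x)⟩

theorem mulOp_mul {f g : ℝ → ℂ} (hf : Bdd f) (hg : Bdd g) :
    mulOp f * mulOp g = mulOp fun x => f x * g x := by
  ext1 ξ
  refine Lp.ext ?_
  rw [mul_apply_eq_comp]
  filter_upwards [mulOp_coeFn hf (mulOp g ξ), mulOp_coeFn hg ξ, mulOp_coeFn (hf.mul hg) ξ]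
    with x h1 h2 h3
  rw [h1, h2, h3, mul_assoc]

theorem mulOp_add {f g : ℝ → ℂ} (hf : Bdd f) (hg : Bdd g) :
    mulOp f + mulOp g = mulOp fun x => f x + g x := by
  ext1 ξ
  refine Lp.ext ?_
  rw [add_apply]
  filter_upwards [mulOp_coeFn hf ξ, mulOp_coeFn hg ξ, mulOp_coeFn (hf.add hg) ξ,
    Lp.coeFn_add (mulOp f ξ) (mulOp g ξ)] with x h1 h2 h3 h4
  rw [h4, Pi.add_apply, h1, h2, h3, add_mul]

theorem mulOp_sub {f g : ℝ → ℂ} (hf : Bdd f) (hg : Bdd g) :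
    mulOp f - mulOp g = mulOp fun x => f x - g x := by
  have h := mulOp_add (hf.sub hg) hg
  simp only [sub_add_cancel] at h
  rw [← h, add_sub_cancel_right]

theorem mulOp_const (c : ℂ) : mulOp (fun _ => c) = c • (1 : L2R →L[ℂ] L2R) := by
  ext1 ξ
  refine Lp.ext ?_
  filter_upwards [mulOp_coeFn (Bdd.const c) ξ, Lp.coeFn_smul c ξ] with x h1 h2
  rw [h1, smul_apply, one_apply_eq_self, h2, Pi.smul_apply, smul_eq_mul]

theorem mulOp_one : mulOp (fun _ => 1) = 1 := by
  rw [mulOp_const, one_smul]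

theorem mulOp_congr_mul_eq {f g : ℝ → ℂ} (hf : Bdd f) (hg : Bdd g) (h : ∀ x, f x * g x = f x) :
    mulOp f * mulOp g = mulOp f := by
  rw [mulOp_mul hf hg, funext h]

theorem norm_mulOp_le (f : ℝ → ℂ) {C : ℝ} (hC : ∀ x, ‖f x‖ ≤ C) : ‖mulOp f‖ ≤ C := by
  have hC0 : 0 ≤ C := (norm_nonneg _).trans (hC 0)
  by_cases hf : MemLp f ⊤ (volume : Measure ℝ)
  · refine ContinuousLinearMap.opNorm_le_bound _ hC0 fun ξ => ?_
    have h1 := (ContinuousLinearMap.mul ℂ ℂ).coeFn_holder (r := 2) hf.toLp ξ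
    refine Lp.norm_le_mul_norm_of_ae_le_mul ?_
    filter_upwards [h1, hf.coeFn_toLp] with x hx1 hx2
    rw [mulOp, dif_pos hf, ContinuousLinearMap.holderL_apply_apply, hx1, hx2]
    simp only [ContinuousLinearMap.mul_apply', norm_mul]
    exact mul_le_mul_of_nonneg_right (hC x) (norm_nonneg _)
  · rw [mulOp, dif_neg hf, norm_zero]
    exact hC0

theorem inner_mulOp {f : ℝ → ℂ} (hf : Bdd f) (η ξ : L2R) :
    inner ℂ η (mulOp f ξ) = ∫ x, f x * (starRingEnd ℂ (η x) * ξ x) := by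
  rw [L2.inner_def]
  refine integral_congr_ae ?_
  filter_upwards [mulOp_coeFn hf ξ] with x h1
  rw [h1, RCLike.inner_apply]
  ring

theorem star_mulOp {f : ℝ → ℂ} (hf : Bdd f) :
    star (mulOp f) = mulOp fun x => starRingEnd ℂ (f x) := by
  rw [ContinuousLinearMap.star_eq_adjoint]
  symm
  rw [ContinuousLinearMap.eq_adjoint_iff]
  intro ξ η
  rw [L2.inner_def, L2.inner_def]
  refine integral_congr_ae ?_
  filter_upwards [mulOp_coeFn hf η, mulOp_coeFn hf.conj ξ] with x h1 h2
  rw [h1, h2, RCLike.inner_apply, RCLike.inner_apply, map_mul, Complex.conj_conj]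
  ring

/-! ### Translations -/

/-- Translation as a bounded operator. -/
def trOp (t : ℝ) : L2R →L[ℂ] L2R := (translation t).toContinuousLinearMap

theorem trOp_apply (t : ℝ) (ξ : L2R) : trOp t ξ = translation t ξ := rfl

theorem ae_comp_sub {p : ℝ → Prop} (h : ∀ᵐ x, p x) (t : ℝ) : ∀ᵐ x : ℝ, p (x - t) :=
  (measurePreserving_sub_right volume t).quasiMeasurePreserving.ae h

theorem trOp_mul (s t : ℝ) : trOp s * trOp t = trOp (s + t) := by
  ext1 ξ
  refine Lp.ext ?_
  rw [mul_apply_eq_comp, trOp_apply, trOp_apply, trOp_apply]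
  filter_upwards [translation_coeFn s (translation t ξ), ae_comp_sub (translation_coeFn t ξ) s,
    translation_coeFn (s + t) ξ] with x h1 h2 h3
  rw [h1, h2, h3, sub_sub]

theorem trOp_zero : trOp 0 = 1 := by
  ext1 ξ
  refine Lp.ext ?_
  filter_upwards [translation_coeFn 0 ξ] with x h1
  rw [trOp_apply, h1, sub_zero, one_apply_eq_self]

theorem trOp_mul_neg (t : ℝ) : trOp t * trOp (-t) = 1 := by
  rw [trOp_mul, add_neg_cancel, trOp_zero]

theorem star_trOp (t : ℝ) : star (trOp t) = trOp (-t) := by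
  rw [ContinuousLinearMap.star_eq_adjoint]
  symm
  rw [ContinuousLinearMap.eq_adjoint_iff]
  intro ξ η
  rw [trOp_apply t, ← (translation t).inner_map_map, ← trOp_apply t, ← mul_apply_eq_comp,
    trOp_mul_neg, one_apply_eq_self]

theorem mulOp_mul_trOp {f : ℝ → ℂ} (hf : Bdd f) (t : ℝ) :
    mulOp f * trOp t = trOp t * mulOp fun x => f (x + t) := by
  have hft : Bdd fun x => f (x + t) := hf.comp (measurable_add_const t)
  ext1 ξ
  refine Lp.ext ?_
  rw [mul_apply_eq_comp, mul_apply_eq_comp, trOp_apply, trOp_apply]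
  filter_upwards [mulOp_coeFn hf (translation t ξ), translation_coeFn t ξ,
    translation_coeFn t (mulOp (fun x => f (x + t)) ξ),
    ae_comp_sub (mulOp_coeFn hft ξ) t] with x h1 h2 h3 h4
  rw [h1, h2, h3, h4, sub_add_cancel]

theorem trOp_mul_mulOp {f : ℝ → ℂ} (hf : Bdd f) (t : ℝ) :
    trOp t * mulOp f = (mulOp fun x => f (x - t)) * trOp t := by
  have hft : Bdd fun x => f (x - t) := hf.comp (measurable_sub_const t)
  rw [mulOp_mul_trOp hft]
  simp only [add_sub_cancel_right]

/-! ### Convolution operators -/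

theorem convRep_apply (g : Lp ℂ 1 (volume : Measure ℝ)) (ξ : L2R) :
    convRep g ξ = ∫ t : ℝ, g t • trOp t ξ := rfl

theorem norm_convRep_le (g : Lp ℂ 1 (volume : Measure ℝ)) : ‖convRep g‖ ≤ ‖g‖ :=
  LinearMap.mkContinuous_norm_le _ (norm_nonneg _) _

theorem integrable_smul_trOp (g : Lp ℂ 1 (volume : Measure ℝ)) (ξ : L2R) :
    Integrable (fun t : ℝ => g t • trOp t ξ) volume :=
  integrable_smul_translation g ξ

theorem convRep_toL1 {g : ℝ → ℂ} (hg : Integrable g) (ξ : L2R) :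
    convRep (hg.toL1 g) ξ = ∫ t : ℝ, g t • trOp t ξ := by
  rw [convRep_apply]
  refine integral_congr_ae ?_
  filter_upwards [hg.coeFn_toL1] with t ht
  rw [ht]

/-- Bounded operators pass under the Bochner integral, so identities and estimates for convolution
operators reduce to those for single translations. -/
theorem mul_convRep_mul_apply (A B : L2R →L[ℂ] L2R) (g : Lp ℂ 1 (volume : Measure ℝ)) (ξ : L2R) :
    (A * convRep g * B) ξ = ∫ t : ℝ, g t • (A * trOp t * B) ξ := by
  simp only [mul_apply_eq_comp]
  rw [convRep_apply, ← ContinuousLinearMap.integral_comp_comm A (integrable_smul_trOp g (B ξ))]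
  simp only [map_smul]

theorem inner_convRep (g : Lp ℂ 1 (volume : Measure ℝ)) (η ξ : L2R) :
    inner ℂ η (convRep g ξ) = ∫ t : ℝ, g t * inner ℂ η (trOp t ξ) := by
  rw [convRep_apply, ← innerSL_apply_apply ℂ η,
    ← ContinuousLinearMap.integral_comp_comm _ (integrable_smul_trOp g ξ)]
  simp only [map_smul, innerSL_apply_apply, smul_eq_mul]

/-- The integrated regular representation as a bounded linear map on `L¹(ℝ)`. -/
def convL : Lp ℂ 1 (volume : Measure ℝ) →L[ℂ] (L2R →L[ℂ] L2R) :=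
  LinearMap.mkContinuous
    { toFun := convRep
      map_add' := fun g h => by
        ext1 ξ
        rw [add_apply, convRep_apply, convRep_apply, convRep_apply,
          ← integral_add (integrable_smul_trOp g ξ) (integrable_smul_trOp h ξ)]
        refine integral_congr_ae ?_
        filter_upwards [Lp.coeFn_add g h] with t ht
        rw [ht, Pi.add_apply, add_smul]
      map_smul' := fun c g => by
        ext1 ξ
        rw [smul_apply, convRep_apply, convRep_apply, RingHom.id_apply, ← integral_smul]
        refine integral_congr_ae ?_
        filter_upwards [Lp.coeFn_smul c g] with t ht
        rw [ht, Pi.smul_apply, smul_assoc] }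
    1 fun g => by rw [one_mul]; exact norm_convRep_le g

theorem convL_apply (g : Lp ℂ 1 (volume : Measure ℝ)) : convL g = convRep g := rfl

/-- Translation on `L¹(ℝ)`. -/
def translationL1 (t : ℝ) : Lp ℂ 1 (volume : Measure ℝ) →ₗᵢ[ℂ] Lp ℂ 1 (volume : Measure ℝ) :=
  Lp.compMeasurePreservingₗᵢ ℂ (fun x : ℝ => x - t) (measurePreserving_sub_right volume t)

theorem translationL1_coeFn (t : ℝ) (g : Lp ℂ 1 (volume : Measure ℝ)) :
    translationL1 t g =ᵐ[volume] fun x => g (x - t) :=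
  Lp.coeFn_compMeasurePreserving g (measurePreserving_sub_right volume t)

theorem continuous_translationL1 (k : Lp ℂ 1 (volume : Measure ℝ)) :
    Continuous fun t : ℝ => translationL1 t k := by
  let g : ℝ → C(ℝ, ℝ) := fun t => ⟨fun x => x - t, by fun_prop⟩
  have hg : Continuous g := by
    refine ContinuousMap.continuous_of_continuous_uncurry _ ?_
    change Continuous fun p : ℝ × ℝ => p.2 - p.1
    fun_prop
  exact (continuous_const (y := k)).compMeasurePreservingLp hg
    (fun t => measurePreserving_sub_right volume t) (by simp)

theorem integrable_smul_translationL1 (g k : Lp ℂ 1 (volume : Measure ℝ)) :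
    Integrable (fun t : ℝ => g t • translationL1 t k) volume := by
  refine ((L1.integrable_coeFn g).norm.mul_const ‖k‖).mono'
    ((Lp.aestronglyMeasurable g).smul (continuous_translationL1 k).aestronglyMeasurable) ?_
  refine Eventually.of_forall fun t => ?_
  simp [norm_smul]

theorem convRep_translationL1 (s : ℝ) (k : Lp ℂ 1 (volume : Measure ℝ)) :
    convRep (translationL1 s k) = trOp s * convRep k := by
  ext1 ξ
  have h1 := mul_convRep_mul_apply (trOp s) 1 k ξ
  rw [mul_one] at h1
  simp only [mul_one, trOp_mul] at h1
  rw [h1, convRep_apply]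
  rw [← integral_add_right_eq_self _ s]
  refine integral_congr_ae ?_
  have h2 : ∀ᵐ t : ℝ, translationL1 s k (t + s) = k (t + s - s) :=
    (measurePreserving_add_right volume s).quasiMeasurePreserving.ae (translationL1_coeFn s k)
  filter_upwards [h2] with t ht
  rw [ht, add_sub_cancel_right, add_comm]

/-- The convolution product on `L¹(ℝ)`. -/
def convL1 (g k : Lp ℂ 1 (volume : Measure ℝ)) : Lp ℂ 1 (volume : Measure ℝ) :=
  ∫ t : ℝ, g t • translationL1 t k

/-- The product is itself a Bochner integral of translates in L¹, so the bounded map `convL` goes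
under the integral and no kernel computation is needed. -/
theorem convRep_convL1 (g k : Lp ℂ 1 (volume : Measure ℝ)) :
    convRep (convL1 g k) = convRep g * convRep k := by
  rw [← convL_apply, convL1,
    ← ContinuousLinearMap.integral_comp_comm _ (integrable_smul_translationL1 g k)]
  have hi := convL.integrable_comp (integrable_smul_translationL1 g k)
  ext1 ξ
  rw [ContinuousLinearMap.integral_apply hi, mul_apply_eq_comp, convRep_apply]
  refine integral_congr_ae (Eventually.of_forall fun t => ?_)
  simp only [map_smul, smul_apply, convL_apply, convRep_translationL1, mul_apply_eq_comp]

theorem integrable_conj_neg (g : Lp ℂ 1 (volume : Measure ℝ)) :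
    Integrable fun t : ℝ => starRingEnd ℂ (g (-t)) := by
  have h : Integrable fun t : ℝ => g (-t) := (L1.integrable_coeFn g).comp_neg
  exact (LinearIsometryEquiv.integrable_comp_iff
    (Complex.conjLIE : ℂ ≃ₗᵢ[ℝ] ℂ)).mpr h

theorem star_convRep (g : Lp ℂ 1 (volume : Measure ℝ)) :
    star (convRep g) = convRep ((integrable_conj_neg g).toL1 _) := by
  rw [ContinuousLinearMap.star_eq_adjoint]
  symm
  rw [ContinuousLinearMap.eq_adjoint_iff]
  intro ξ η
  rw [← inner_conj_symm, inner_convRep, inner_convRep, ← integral_conj,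
    ← integral_neg_eq_self]
  refine integral_congr_ae ?_
  have h2 := (Measure.measurePreserving_neg (volume : Measure ℝ)).quasiMeasurePreserving.ae
    (integrable_conj_neg g).coeFn_toL1
  filter_upwards [h2] with t ht
  rw [ht, map_mul, neg_neg, Complex.conj_conj, inner_conj_symm]
  congr 1
  rw [← ContinuousLinearMap.adjoint_inner_right, ← ContinuousLinearMap.star_eq_adjoint, star_trOp,
    neg_neg]

/-- Convolution operators by L¹ functions are already closed under products and adjoints, so only
the closure remains. Closed properties can then be checked on L¹ alone. -/
theorem coe_groupCStar : (groupCStar : Set (L2R →L[ℂ] L2R)) = closure (Set.range convRep) := by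
  let S : NonUnitalStarSubalgebra ℂ (L2R →L[ℂ] L2R) :=
    { carrier := Set.range convRep
      add_mem' := by
        rintro _ _ ⟨g, rfl⟩ ⟨h, rfl⟩
        exact ⟨g + h, map_add convL g h⟩
      zero_mem' := ⟨0, map_zero convL⟩
      mul_mem' := by
        rintro _ _ ⟨g, rfl⟩ ⟨h, rfl⟩
        exact ⟨convL1 g h, convRep_convL1 g h⟩
      smul_mem' := by
        rintro c _ ⟨g, rfl⟩
        exact ⟨c • g, map_smul convL c g⟩
      star_mem' := by
        rintro _ ⟨g, rfl⟩
        exact ⟨_, (star_convRep g).symm⟩ }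
  have h : NonUnitalStarAlgebra.adjoin ℂ (Set.range convRep) = S :=
    le_antisymm (NonUnitalStarAlgebra.adjoin_le le_rfl) (NonUnitalStarAlgebra.subset_adjoin ℂ _)
  rw [groupCStar, h]
  rfl

theorem convRep_mem (g : Lp ℂ 1 (volume : Measure ℝ)) : convRep g ∈ groupCStar := by
  rw [← SetLike.mem_coe, coe_groupCStar]
  exact subset_closure ⟨g, rfl⟩

theorem groupCStar_induction {p : (L2R →L[ℂ] L2R) → Prop} (hp : IsClosed {G | p G})
    (h : ∀ g, p (convRep g)) {G : L2R →L[ℂ] L2R} (hG : G ∈ groupCStar) : p G := by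
  rw [← SetLike.mem_coe, coe_groupCStar] at hG
  exact closure_minimal (s := Set.range convRep) (by rintro _ ⟨g, rfl⟩; exact h g) hp hG

theorem convRep_mul_trOp (g : Lp ℂ 1 (volume : Measure ℝ)) (s : ℝ) :
    convRep g * trOp s = trOp s * convRep g := by
  ext1 ξ
  have h1 := mul_convRep_mul_apply 1 (trOp s) g ξ
  have h2 := mul_convRep_mul_apply (trOp s) 1 g ξ
  simp only [mul_one, one_mul, trOp_mul] at h1 h2
  rw [h1, h2]
  simp only [add_comm]

theorem mul_trOp_of_mem {G : L2R →L[ℂ] L2R} (hG : G ∈ groupCStar) (s : ℝ) :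
    G * trOp s = trOp s * G := by
  refine groupCStar_induction (p := fun G => G * trOp s = trOp s * G) ?_
    (fun g => convRep_mul_trOp g s) hG
  exact isClosed_eq (by fun_prop) (by fun_prop)

/-! ### Modulations -/

/-- The character `x ↦ exp(2πisx)` of the line. -/
def ch (s x : ℝ) : ℂ := Real.fourierChar (s * x)

theorem norm_ch (s x : ℝ) : ‖ch s x‖ = 1 := Circle.norm_coe _

theorem continuous_ch (s : ℝ) : Continuous (ch s) := by
  unfold ch
  have := Real.continuous_fourierChar
  fun_prop

theorem bdd_ch (s : ℝ) : Bdd (ch s) := ⟨(continuous_ch s).measurable, 1, fun x => (norm_ch s x).le⟩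

theorem ch_add (s x y : ℝ) : ch s (x + y) = ch s x * ch s y := by
  rw [ch, mul_add, AddChar.map_add_eq_mul, Circle.coe_mul]
  rfl

theorem ch_neg_mul (s x : ℝ) : ch (-s) x * ch s x = 1 := by
  rw [ch, ch, ← Circle.coe_mul, ← AddChar.map_add_eq_mul, neg_mul, neg_add_cancel]
  simp

theorem ch_mul_neg (s x : ℝ) : ch s x * ch (-s) x = 1 := by
  rw [mul_comm, ch_neg_mul]

theorem mulOp_ch_mul_neg (s : ℝ) : mulOp (ch s) * mulOp (ch (-s)) = 1 := by
  rw [mulOp_mul (bdd_ch s) (bdd_ch (-s))]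
  simp only [ch_mul_neg, mulOp_one]

/-- The Weyl commutation relation. Integrated against g, it says that conjugation by a character
multiplies g by that character, which is a translation of its Fourier transform. -/
theorem modulate_trOp (s t : ℝ) :
    mulOp (ch s) * trOp t * mulOp (ch (-s)) = ch s t • trOp t := by
  rw [mul_assoc, trOp_mul_mulOp (bdd_ch (-s)), ← mul_assoc,
    mulOp_mul (bdd_ch s) ((bdd_ch (-s)).comp (measurable_sub_const t))]
  have h : ∀ x, ch s x * ch (-s) (x - t) = ch s t := fun x => by
    have h1 := ch_add s (x - t) t
    rw [sub_add_cancel] at h1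
    rw [h1, mul_right_comm, ch_mul_neg, one_mul]
  simp only [h]
  rw [mulOp_const, smul_mul_assoc, one_mul]

theorem modulate_convRep_apply (s : ℝ) (g : Lp ℂ 1 (volume : Measure ℝ)) (ξ : L2R) :
    (mulOp (ch s) * convRep g * mulOp (ch (-s))) ξ = ∫ t : ℝ, ch s t • g t • trOp t ξ := by
  rw [mul_convRep_mul_apply]
  refine integral_congr_ae (Eventually.of_forall fun t => ?_)
  simp only [modulate_trOp, smul_apply]
  rw [smul_comm]

theorem integrable_mul_coeFn {b : ℝ → ℂ} (hb : Bdd b) {g : ℝ → ℂ} (hg : Integrable g) :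
    Integrable fun t => b t * g t :=
  hg.bdd_mul hb.meas.aestronglyMeasurable (Eventually.of_forall hb.bound.choose_spec)

theorem modulate_convRep (s : ℝ) {g : ℝ → ℂ} (hg : Integrable g) :
    mulOp (ch s) * convRep (hg.toL1 g) * mulOp (ch (-s)) =
      convRep ((integrable_mul_coeFn (bdd_ch s) hg).toL1 _) := by
  ext1 ξ
  rw [modulate_convRep_apply, convRep_toL1]
  refine integral_congr_ae ?_
  filter_upwards [hg.coeFn_toL1] with t ht
  rw [ht, smul_smul]

theorem norm_mulOp_ch_le (s : ℝ) : ‖mulOp (ch s)‖ ≤ 1 :=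
  norm_mulOp_le _ fun x => (norm_ch s x).le

theorem norm_modulate_le (s : ℝ) (A : L2R →L[ℂ] L2R) :
    ‖mulOp (ch s) * A * mulOp (ch (-s))‖ ≤ ‖A‖ := by
  calc _ ≤ ‖mulOp (ch s)‖ * ‖A‖ * ‖mulOp (ch (-s))‖ :=
        (norm_mul_le _ _).trans (mul_le_mul_of_nonneg_right (norm_mul_le _ _) (norm_nonneg _))
    _ ≤ 1 * ‖A‖ * 1 := by gcongr <;> exact norm_mulOp_ch_le _
    _ = ‖A‖ := by ring

theorem modulate_mem (s : ℝ) {G : L2R →L[ℂ] L2R} (hG : G ∈ groupCStar) :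
    mulOp (ch s) * G * mulOp (ch (-s)) ∈ groupCStar := by
  refine groupCStar_induction (p := fun G => mulOp (ch s) * G * mulOp (ch (-s)) ∈ groupCStar) ?_
    (fun g => ?_) hG
  · exact (NonUnitalStarSubalgebra.isClosed_topologicalClosure _).preimage (by fun_prop)
  · have := modulate_convRep s (L1.integrable_coeFn g)
    rw [Integrable.toL1_coeFn] at this
    rw [this]
    exact convRep_mem _

/-- The Riemann–Lebesgue lemma for the group C⋆-algebra. -/
theorem tendsto_modulate_apply {G : L2R →L[ℂ] L2R} (hG : G ∈ groupCStar) (ξ : L2R) :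
    Tendsto (fun s : ℝ => (mulOp (ch s) * G * mulOp (ch (-s))) ξ) atTop (𝓝 0) := by
  rw [← SetLike.mem_coe, coe_groupCStar, Metric.mem_closure_iff] at hG
  have hconv : ∀ g : Lp ℂ 1 (volume : Measure ℝ),
      Tendsto (fun s : ℝ => (mulOp (ch s) * convRep g * mulOp (ch (-s))) ξ) atTop (𝓝 0) := by
    intro g
    -- The Riemann–Lebesgue integral carries the opposite sign in the exponent, hence the
    -- composition with negation.
    have h := (Real.tendsto_integral_exp_smul_cocompact fun t => g t • trOp t ξ).comp
      ((tendsto_neg_atTop_atBot (G := ℝ)).mono_right atBot_le_cocompact)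
    refine h.congr fun s => ?_
    rw [modulate_convRep_apply]
    refine integral_congr_ae (Eventually.of_forall fun t => ?_)
    simp only [ch, Circle.smul_def]
    congr 3
    ring
  rw [Metric.tendsto_nhds]
  intro ε hε
  obtain ⟨_, ⟨g, rfl⟩, hg⟩ := hG (ε / 2 / (‖ξ‖ + 1)) (by positivity)
  have h2 := Metric.tendsto_nhds.mp (hconv g) (ε / 2) (by positivity)
  filter_upwards [h2] with s hs
  rw [dist_zero_right] at hs ⊢
  have h3 : (mulOp (ch s) * G * mulOp (ch (-s))) ξ =
      (mulOp (ch s) * (G - convRep g) * mulOp (ch (-s))) ξ +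
        (mulOp (ch s) * convRep g * mulOp (ch (-s))) ξ := by
    rw [mul_sub, sub_mul, sub_apply, sub_add_cancel]
  rw [dist_eq_norm] at hg
  have h4 : ‖(mulOp (ch s) * (G - convRep g) * mulOp (ch (-s))) ξ‖ ≤ ε / 2 := by
    refine (ContinuousLinearMap.le_opNorm _ _).trans ?_
    have h5 := (norm_modulate_le s (G - convRep g)).trans hg.le
    calc _ ≤ ε / 2 / (‖ξ‖ + 1) * (‖ξ‖ + 1) := by gcongr; linarith
      _ = ε / 2 := by field_simp
  rw [h3]
  refine (norm_add_le _ _).trans_lt ?_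
  linarith

/-! ### Compact operators on a Hilbert space -/

section CompactOperators

variable {H : Type*} [NormedAddCommGroup H] [InnerProductSpace ℂ H]

theorem isCompactOperator_rankOne (x y : H) :
    IsCompactOperator (InnerProductSpace.rankOne ℂ x y) := by
  rw [InnerProductSpace.rankOne_def']
  exact (isCompactOperator_of_locallyCompactSpace_rng
    (ContinuousLinearMap.toSpanSingleton ℂ x)).comp_clm _

theorem _root_.IsCompactOperator.mul_left {T : H →L[ℂ] H} (hT : IsCompactOperator T) (A : H →L[ℂ] H) :
    IsCompactOperator (A * T) := hT.clm_comp A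

theorem _root_.IsCompactOperator.mul_right {T : H →L[ℂ] H} (hT : IsCompactOperator T) (A : H →L[ℂ] H) :
    IsCompactOperator (T * A) := hT.comp_clm A

variable [CompleteSpace H]

theorem isClosed_compact : IsClosed {T : H →L[ℂ] H | IsCompactOperator T} :=
  isClosed_setOfPred_isCompactOperator

/-- Take a finite ε/2-net of the image of the unit ball and let P project onto its span. Then PT has
finite rank, and PTx is at least as close to Tx as any point of the net. -/
theorem _root_.IsCompactOperator.mem_closure_span {T : H →L[ℂ] H} (hT : IsCompactOperator T) :
    T ∈ closure (Submodule.span ℂ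
      {S : H →L[ℂ] H | ∃ x y, S = InnerProductSpace.rankOne ℂ x y} : Set (H →L[ℂ] H)) := by
  rw [Metric.mem_closure_iff]
  intro ε hε
  have hK : IsCompact (closure (T '' Metric.closedBall 0 1)) :=
    hT.isCompact_closure_image_closedBall (f := T.toLinearMap) 1
  obtain ⟨t, ht, hcov⟩ := Metric.totallyBounded_iff.mp hK.totallyBounded (ε / 2) (by positivity)
  let S : Submodule ℂ H := Submodule.span ℂ t
  have : FiniteDimensional ℂ S := FiniteDimensional.span_of_finite ℂ ht
  let b := stdOrthonormalBasis ℂ S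
  have hP : S.starProjection * T =
      ∑ i, InnerProductSpace.rankOne ℂ (b i : H) (ContinuousLinearMap.adjoint T (b i)) := by
    ext1 x
    rw [mul_apply_eq_comp, b.starProjection_eq_sum_rankOne, sum_apply, sum_apply]
    refine Finset.sum_congr rfl fun i _ => ?_
    rw [InnerProductSpace.rankOne_apply, InnerProductSpace.rankOne_apply,
      ContinuousLinearMap.adjoint_inner_left]
  refine ⟨S.starProjection * T, ?_, ?_⟩
  · rw [hP]
    exact Submodule.sum_mem _ fun i _ => Submodule.subset_span ⟨_, _, rfl⟩
  · rw [dist_eq_norm]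
    refine lt_of_le_of_lt ?_ (half_lt_self hε)
    refine ContinuousLinearMap.opNorm_le_of_unit_norm (by positivity) fun x hx => ?_
    have hmem : T x ∈ closure (T '' Metric.closedBall 0 1) :=
      subset_closure ⟨x, by simp [hx], rfl⟩
    obtain ⟨y, hy, hxy⟩ := Set.mem_iUnion₂.mp (hcov hmem)
    rw [sub_apply, mul_apply_eq_comp, Submodule.starProjection_minimal]
    refine (ciInf_le ⟨0, ?_⟩ (⟨y, Submodule.subset_span hy⟩ : S)).trans ?_
    · rintro _ ⟨z, rfl⟩
      exact norm_nonneg _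
    · rw [← dist_eq_norm]
      exact (Metric.mem_ball.mp hxy).le

theorem _root_.IsCompactOperator.induction {p : (H →L[ℂ] H) → Prop} (hp : IsClosed {T | p T})
    (hr : ∀ x y, p (InnerProductSpace.rankOne ℂ x y)) (h0 : p 0)
    (hadd : ∀ S T, p S → p T → p (S + T)) (hsmul : ∀ (c : ℂ) T, p T → p (c • T))
    {T : H →L[ℂ] H} (hT : IsCompactOperator T) : p T := by
  refine closure_minimal ?_ hp hT.mem_closure_span
  intro S hS
  refine Submodule.span_induction (p := fun S _ => p S) ?_ h0 (fun x y _ _ => hadd x y)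
    (fun c x _ => hsmul c x) hS
  rintro _ ⟨x, y, rfl⟩
  exact hr x y

/-- Schauder's theorem, by approximation: the adjoint of a rank-one operator has rank at most one,
and the adjoint is isometric. -/
theorem _root_.IsCompactOperator.star_clm {T : H →L[ℂ] H} (hT : IsCompactOperator T) :
    IsCompactOperator (star T : H →L[ℂ] H) := by
  refine IsCompactOperator.induction (p := fun T => IsCompactOperator (Star.star T : H →L[ℂ] H))
    ?_ ?_ ?_ ?_ ?_ hT
  · exact isClosed_compact.preimage continuous_star
  · intro x y
    rw [ContinuousLinearMap.star_eq_adjoint, InnerProductSpace.adjoint_rankOne]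
    exact isCompactOperator_rankOne y x
  · rw [star_zero]
    exact isCompactOperator_zero
  · intro S T hS hT
    rw [star_add]
    exact hS.add hT
  · intro c T hT
    rw [star_smul]
    exact hT.smul _

/-- Compact operators send bounded weakly null families to norm-null ones. This is immediate for
rank one, and boundedness of both families lets it pass to norm limits. -/
theorem _root_.IsCompactOperator.tendsto_inner {T : H →L[ℂ] H} (hT : IsCompactOperator T)
    {ι : Type*} {l : Filter ι} {v w : ι → H} {C : ℝ} (hv : ∀ i, ‖v i‖ ≤ C) (hw : ∀ i, ‖w i‖ ≤ C)
    (hweak : ∀ x, Tendsto (fun i => inner ℂ x (v i)) l (𝓝 0)) :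
    Tendsto (fun i => inner ℂ (w i) (T (v i))) l (𝓝 0) := by
  refine IsCompactOperator.induction
    (p := fun T => Tendsto (fun i => inner ℂ (w i) (T (v i))) l (𝓝 0)) ?_ ?_ ?_ ?_ ?_ hT
  · refine isClosed_of_closure_subset fun T hT => ?_
    rw [Metric.mem_closure_iff] at hT
    rw [Set.mem_ofPred_eq, Metric.tendsto_nhds]
    intro ε hε
    obtain ⟨S, hS, hTS⟩ := hT (ε / 2 / (C ^ 2 + 1)) (by positivity)
    filter_upwards [Metric.tendsto_nhds.mp hS (ε / 2) (by positivity)] with i hi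
    rw [dist_zero_right] at hi ⊢
    have h1 : inner ℂ (w i) (T (v i)) = inner ℂ (w i) ((T - S) (v i)) + inner ℂ (w i) (S (v i)) := by
      rw [sub_apply, inner_sub_right, sub_add_cancel]
    have hC : 0 ≤ C := (norm_nonneg _).trans (hv i)
    have h2 : ‖(inner ℂ (w i) ((T - S) (v i)) : ℂ)‖ ≤ ε / 2 := by
      rw [dist_eq_norm] at hTS
      calc _ ≤ ‖w i‖ * (‖T - S‖ * ‖v i‖) := (norm_inner_le_norm _ _).trans
            (mul_le_mul_of_nonneg_left ((T - S).le_opNorm _) (norm_nonneg _))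
        _ ≤ C * (ε / 2 / (C ^ 2 + 1) * C) := by gcongr <;> first | exact hv i | exact hw i
        _ = ε / 2 * (C ^ 2 / (C ^ 2 + 1)) := by ring
        _ ≤ ε / 2 * 1 := by
            gcongr
            rw [div_le_one (by positivity)]
            linarith
        _ = ε / 2 := mul_one _
    rw [h1]
    refine (norm_add_le _ _).trans_lt ?_
    linarith
  · intro x y
    refine squeeze_zero_norm (a := fun i => ‖(inner ℂ y (v i) : ℂ)‖ * (C * ‖x‖)) (fun i => ?_) ?_
    · rw [InnerProductSpace.rankOne_apply, inner_smul_right, norm_mul]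
      gcongr
      exact (norm_inner_le_norm _ _).trans (by gcongr; exact hw i)
    · simpa using (hweak y).norm.mul_const (C * ‖x‖)
  · simpa using tendsto_const_nhds
  · intro S T hS hT
    simpa [inner_add_right] using hS.add hT
  · intro c T hT
    simpa [inner_smul_right] using hT.const_mul c

end CompactOperators

/-! ### Compactness of localized convolution operators -/

/-- The indicator function of `[-R, R]`. -/
def ind (R : ℝ) : ℝ → ℂ := (Set.Icc (-R) R).indicator fun _ => 1

theorem ind_of_le {R x : ℝ} (h : |x| ≤ R) : ind R x = 1 :=
  Set.indicator_of_mem (Set.mem_Icc.mpr (abs_le.mp h)) _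

theorem ind_of_lt {R x : ℝ} (h : R < |x|) : ind R x = 0 :=
  Set.indicator_of_notMem (fun hx => h.not_ge (abs_le.mpr (Set.mem_Icc.mp hx))) _

theorem bdd_ind (R : ℝ) : Bdd (ind R) := (Bdd.const 1).indicator measurableSet_Icc

theorem conj_ind (R x : ℝ) : starRingEnd ℂ (ind R x) = ind R x := by
  rcases le_or_gt |x| R with h | h
  · simp [ind_of_le h]
  · simp [ind_of_lt h]

theorem memLp_ind (p : ENNReal) (R : ℝ) : MemLp (ind R) p (volume : Measure ℝ) :=
  memLp_indicator_const p measurableSet_Icc 1 (Or.inr measure_Icc_lt_top.ne)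

theorem integrable_ind (R : ℝ) : Integrable (ind R) := memLp_one_iff_integrable.mp (memLp_ind 1 R)

/-- The indicator function of `[-R, R]` as an element of `L¹(ℝ)`. -/
def indL1 (R : ℝ) : Lp ℂ 1 (volume : Measure ℝ) := (integrable_ind R).toL1 _

/-- The indicator function of `[-R, R]` as an element of `L²(ℝ)`. -/
def indL2 (R : ℝ) : L2R := (memLp_ind 2 R).toLp _

theorem star_mulOp_ind (R : ℝ) : star (mulOp (ind R)) = mulOp (ind R) := by
  rw [star_mulOp (bdd_ind R)]
  simp only [conj_ind]

theorem integrable_ind_mul (R : ℝ) (ξ : L2R) : Integrable fun x => ind R x * ξ x :=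
  (memLp_ind 2 R).integrable_mul (Lp.memLp ξ)

theorem inner_indL2 (R : ℝ) (ξ : L2R) : inner ℂ (indL2 R) ξ = ∫ x, ind R x * ξ x := by
  rw [L2.inner_def]
  refine integral_congr_ae ?_
  filter_upwards [(memLp_ind 2 R).coeFn_toLp] with x hx
  rw [indL2, hx, RCLike.inner_apply, conj_ind, mul_comm]

theorem inner_mulOp_trOp {f h : ℝ → ℂ} (hf : Bdd f) (hh : Bdd h) (η ξ : L2R) (t : ℝ) :
    inner ℂ (mulOp f η) (trOp t (mulOp h ξ)) =
      ∫ x, starRingEnd ℂ (f x * η x) * (h (x - t) * ξ (x - t)) := by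
  rw [L2.inner_def]
  refine integral_congr_ae ?_
  filter_upwards [mulOp_coeFn hf η, translation_coeFn t (mulOp h ξ),
    ae_comp_sub (mulOp_coeFn hh ξ) t] with x h1 h2 h3
  rw [h1, trOp_apply, h2, h3, RCLike.inner_apply, mul_comm]

/-- The integral of a convolution is the product of the integrals, applied to the conjugate of a and
the reflection of b. -/
theorem integral_integral_conj_mul {a b : ℝ → ℂ} (ha : Integrable a) (hb : Integrable b) :
    ∫ t, ∫ x, starRingEnd ℂ (a x) * b (x - t) = starRingEnd ℂ (∫ x, a x) * ∫ x, b x := by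
  have ha' : Integrable fun x => starRingEnd ℂ (a x) :=
    (LinearIsometryEquiv.integrable_comp_iff (Complex.conjLIE : ℂ ≃ₗᵢ[ℝ] ℂ)).mpr ha
  have h := integral_convolution (μ := (volume : Measure ℝ)) (ν := volume)
    (ContinuousLinearMap.mul ℝ ℂ) ha' hb.comp_neg
  simp only [ContinuousLinearMap.mul_apply'] at h
  rw [integral_neg_eq_self (fun x => b x), integral_conj] at h
  rw [← h]
  refine integral_congr_ae (Eventually.of_forall fun t => ?_)
  simp only [convolution_def, ContinuousLinearMap.mul_apply', neg_sub]

/-- For x and y in [-R, R] one has |x - y| ≤ 2R ≤ L, so the kernel 1_{[-L,L]}(x - y) is constantly 1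
on the square. All compactness below grows from this one rank-one operator. -/
theorem ind_mul_convRep_indL1_mul_ind {R L : ℝ} (h : 2 * R ≤ L) :
    mulOp (ind R) * convRep (indL1 L) * mulOp (ind R) =
      InnerProductSpace.rankOne ℂ (indL2 R) (indL2 R) := by
  ext1 ξ
  refine ext_inner_left ℂ fun η => ?_
  rw [InnerProductSpace.rankOne_apply, inner_smul_right, ← inner_conj_symm η (indL2 R), inner_indL2,
    inner_indL2, mul_comm,
    ← integral_integral_conj_mul (integrable_ind_mul R η) (integrable_ind_mul R ξ)]
  rw [mul_apply_eq_comp, mul_apply_eq_comp, ← ContinuousLinearMap.adjoint_inner_left,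
    ← ContinuousLinearMap.star_eq_adjoint, star_mulOp_ind, inner_convRep]
  refine integral_congr_ae ?_
  filter_upwards [(integrable_ind L).coeFn_toL1] with t ht
  rw [indL1, ht, inner_mulOp_trOp (bdd_ind R) (bdd_ind R)]
  rcases le_or_gt |t| L with htL | htL
  · rw [ind_of_le htL, one_mul]
  · rw [ind_of_lt htL, zero_mul]
    symm
    refine integral_eq_zero_of_ae (Eventually.of_forall fun x => ?_)
    rcases le_or_gt |x| R with hx | hx
    · have : R < |x - t| := by
        have := abs_sub_abs_le_abs_sub t x
        rw [abs_sub_comm] at this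
        linarith
      simp [ind_of_lt this]
    · simp [ind_of_lt hx]

theorem modulate_indL1 (s L : ℝ) : convRep ((integrable_mul_coeFn (bdd_ch s)
    (integrable_ind L)).toL1 _) = mulOp (ch s) * convRep (indL1 L) * mulOp (ch (-s)) :=
  (modulate_convRep s (integrable_ind L)).symm

theorem mulOp_comm {f g : ℝ → ℂ} (hf : Bdd f) (hg : Bdd g) :
    mulOp f * mulOp g = mulOp g * mulOp f := by
  rw [mulOp_mul hf hg, mulOp_mul hg hf]
  simp only [mul_comm]

theorem isCompactOperator_modulated_ind {R L : ℝ} (h : 2 * R ≤ L) (s : ℝ) :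
    IsCompactOperator (mulOp (ind R) * convRep ((integrable_mul_coeFn (bdd_ch s)
      (integrable_ind L)).toL1 _) * mulOp (ind R)) := by
  have h1 : mulOp (ind R) * convRep ((integrable_mul_coeFn (bdd_ch s)
      (integrable_ind L)).toL1 _) * mulOp (ind R) =
      mulOp (ch s) * (mulOp (ind R) * convRep (indL1 L) * mulOp (ind R)) * mulOp (ch (-s)) := by
    rw [modulate_indL1]
    simp only [mul_assoc]
    rw [mulOp_comm (bdd_ch (-s)) (bdd_ind R), ← mul_assoc, mulOp_comm (bdd_ind R) (bdd_ch s)]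
    simp only [mul_assoc]
  rw [h1, ind_mul_convRep_indL1_mul_ind h]
  exact ((isCompactOperator_rankOne _ _).mul_left _).mul_right _

section Periodic

variable (L : ℝ)

theorem bdd_periodic (q : C(AddCircle (2 * L), ℂ)) [Fact (0 < 2 * L)] :
    Bdd fun x : ℝ => q (x : AddCircle (2 * L)) :=
  ⟨(q.continuous.comp (AddCircle.continuous_mk' _)).measurable, ‖q‖, fun x => q.norm_coe_le_norm x⟩

variable [Fact (0 < 2 * L)]

/-- Restriction of periodic functions to one period, as elements of `L¹(ℝ)`. -/
def periodicL1 : C(AddCircle (2 * L), ℂ) →L[ℂ] Lp ℂ 1 (volume : Measure ℝ) :=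
  LinearMap.mkContinuous
    { toFun := fun q => (integrable_mul_coeFn (bdd_periodic L q) (integrable_ind L)).toL1 _
      map_add' := fun p q => by
        rw [← Integrable.toL1_add, Integrable.toL1_eq_toL1_iff]
        refine Eventually.of_forall fun x => ?_
        simp [add_mul]
      map_smul' := fun c q => by
        rw [RingHom.id_apply, ← Integrable.toL1_smul, Integrable.toL1_eq_toL1_iff]
        refine Eventually.of_forall fun x => ?_
        simp [mul_assoc] }
    (∫ x, ‖ind L x‖) fun q => by
      change ‖(integrable_mul_coeFn (bdd_periodic L q) (integrable_ind L)).toL1 _‖ ≤ _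
      rw [L1.norm_of_fun_eq_integral_norm, ← integral_mul_const]
      refine integral_mono (integrable_mul_coeFn (bdd_periodic L q) (integrable_ind L)).norm
        ((integrable_ind L).norm.mul_const _) fun x => ?_
      simp only [norm_mul]
      rw [mul_comm]
      exact mul_le_mul_of_nonneg_left (q.norm_coe_le_norm _) (norm_nonneg _)

theorem periodicL1_apply (q : C(AddCircle (2 * L), ℂ)) : periodicL1 L q =
    (integrable_mul_coeFn (bdd_periodic L q) (integrable_ind L)).toL1 _ := rfl

/-- Each Fourier monomial is a character, hence gives a compact operator by modulation.
Trigonometric polynomials are dense in the continuous periodic functions, and the functions q giving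
a compact operator form a closed subspace. -/
theorem isCompactOperator_periodic {R : ℝ} (h : 2 * R ≤ L) (q : C(AddCircle (2 * L), ℂ)) :
    IsCompactOperator (mulOp (ind R) * convRep (periodicL1 L q) * mulOp (ind R)) := by
  let A : Submodule ℂ C(AddCircle (2 * L), ℂ) :=
    { carrier := {q | IsCompactOperator (mulOp (ind R) * convL (periodicL1 L q) * mulOp (ind R))}
      add_mem' := fun {p q} hp hq => by
        rw [Set.mem_ofPred_eq, map_add, map_add, mul_add, add_mul]
        exact hp.add hq
      zero_mem' := by
        rw [Set.mem_ofPred_eq, map_zero, map_zero, mul_zero, zero_mul]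
        exact isCompactOperator_zero
      smul_mem' := fun c q hq => by
        rw [Set.mem_ofPred_eq, map_smul, map_smul, mul_smul_comm, smul_mul_assoc]
        exact hq.smul c }
  have hA : IsClosed (A : Set C(AddCircle (2 * L), ℂ)) :=
    isClosed_compact.preimage
      (f := fun q => mulOp (ind R) * convL (periodicL1 L q) * mulOp (ind R)) (by fun_prop)
  have hle : Submodule.span ℂ (Set.range (fourier (T := 2 * L))) ≤ A := by
    rw [Submodule.span_le]
    rintro _ ⟨n, rfl⟩
    have h1 := isCompactOperator_modulated_ind h (n / (2 * L))
    have h2 : (integrable_mul_coeFn (bdd_ch (n / (2 * L))) (integrable_ind L)).toL1 _ =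
        periodicL1 L (fourier n) := by
      rw [periodicL1_apply, Integrable.toL1_eq_toL1_iff]
      refine Eventually.of_forall fun x => ?_
      simp only [fourier_coe_apply, ch, Real.fourierChar_apply]
      congr 2
      push_cast
      ring
    rw [h2] at h1
    exact h1
  have htop := (Submodule.topologicalClosure_minimal _ hle hA)
  rw [span_fourier_closure_eq_top] at htop
  exact htop (Submodule.mem_top (x := q))

end Periodic

/-! ### From periodic kernels to M(f)G with f vanishing at ±∞ -/

theorem exists_support_bound {g : ℝ → ℂ} (hs : HasCompactSupport g) :
    ∃ r : ℝ, ∀ x, r < |x| → g x = 0 := by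
  obtain ⟨r, hr⟩ := hs.isCompact.isBounded.subset_closedBall 0
  refine ⟨r, fun x hx => image_eq_zero_of_notMem_tsupport fun h => ?_⟩
  have := hr h
  rw [mem_closedBall_zero_iff, Real.norm_eq_abs] at this
  linarith

theorem isCompactOperator_ind_convRep_ind {g : ℝ → ℂ} (hg : Integrable g) (hc : Continuous g)
    (hs : HasCompactSupport g) (R : ℝ) :
    IsCompactOperator (mulOp (ind R) * convRep (hg.toL1 g) * mulOp (ind R)) := by
  obtain ⟨r, hsupp⟩ := exists_support_bound hs
  -- The half-period exceeds 2R, so that the rank-one kernel applies, and exceeds r, so that g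
  -- vanishes at ±L and extends periodically.
  set L : ℝ := max (max (2 * R) r) 0 + 1 with hL
  have h0 : 0 < L := by positivity
  have h1 : 2 * R ≤ L := by
    have := (le_max_left (2 * R) r).trans (le_max_left (max (2 * R) r) 0)
    linarith
  have h2 : r < L := by
    have := (le_max_right (2 * R) r).trans (le_max_left (max (2 * R) r) 0)
    linarith
  have : Fact (0 < 2 * L) := ⟨by linarith⟩
  have hgL : g (-L) = g (-L + 2 * L) := by
    rw [hsupp, hsupp]
    · rw [show -L + 2 * L = L by ring, abs_of_pos h0]
      exact h2
    · rw [abs_neg, abs_of_pos h0]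
      exact h2
  let q : C(AddCircle (2 * L), ℂ) :=
    ⟨AddCircle.liftIco (2 * L) (-L) g, AddCircle.liftIco_continuous hgL hc.continuousOn⟩
  have h3 := isCompactOperator_periodic L h1 q
  have h4 : hg.toL1 g = periodicL1 L q := by
    rw [periodicL1_apply, Integrable.toL1_eq_toL1_iff]
    -- The lift uses the period [-L, L) while the indicator is that of [-L, L]; the extra endpoint
    -- is null.
    have hne : ∀ᵐ x : ℝ, x ≠ L := by simp [ae_iff]
    filter_upwards [hne] with x hxne
    rcases le_or_gt |x| L with hx | hx
    · rw [ind_of_le hx, mul_one]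
      symm
      refine AddCircle.liftIco_coe_apply ⟨(abs_le.mp hx).1, ?_⟩
      rw [show -L + 2 * L = L by ring]
      exact lt_of_le_of_ne (abs_le.mp hx).2 hxne
    · rw [ind_of_lt hx, mul_zero, hsupp x (h2.trans hx)]
  rw [h4]
  exact h3

/-- Finite propagation: for g supported in [-r, r], the convolution on [-R, R] only sees the
argument on [-R - r, R + r]. -/
theorem ind_mul_convRep_mul_ind {g : ℝ → ℂ} (hg : Integrable g) {r : ℝ}
    (hs : ∀ x, r < |x| → g x = 0) (R : ℝ) :
    mulOp (ind R) * convRep (hg.toL1 g) * mulOp (ind (R + r)) =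
      mulOp (ind R) * convRep (hg.toL1 g) := by
  ext1 ξ
  have h := mul_convRep_mul_apply (mulOp (ind R)) 1 (hg.toL1 g) ξ
  simp only [mul_one] at h
  rw [h, mul_convRep_mul_apply]
  refine integral_congr_ae ?_
  filter_upwards [hg.coeFn_toL1] with t ht
  rw [ht]
  rcases le_or_gt |t| r with htr | htr
  · rw [mul_assoc, trOp_mul_mulOp (bdd_ind _), ← mul_assoc,
      mulOp_congr_mul_eq (bdd_ind R) ((bdd_ind _).comp (measurable_sub_const t)) fun x => ?_]
    rcases le_or_gt |x| R with hx | hx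
    · rw [ind_of_le (R := R + r), mul_one]
      exact (abs_sub _ _).trans (add_le_add hx htr)
    · rw [ind_of_lt hx, zero_mul]
  · rw [hs t htr, zero_smul, zero_smul]

theorem convRep_dense_induction {p : (L2R →L[ℂ] L2R) → Prop} (hp : IsClosed {G | p G})
    (h : ∀ (g : ℝ → ℂ) (hg : Integrable g), Continuous g → HasCompactSupport g →
      p (convRep (hg.toL1 g))) {G : L2R →L[ℂ] L2R} (hG : G ∈ groupCStar) : p G := by
  refine groupCStar_induction hp (fun k => ?_) hG
  have hk : k ∈ closure {k : Lp ℂ 1 (volume : Measure ℝ) | p (convRep k)} := by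
    rw [Metric.mem_closure_iff]
    intro ε hε
    obtain ⟨g, hgs, hgi, hgc, hg⟩ :=
      (L1.integrable_coeFn k).exists_hasCompactSupport_integral_sub_le (half_pos hε)
    refine ⟨hg.toL1 g, h g hg hgc hgs, ?_⟩
    rw [dist_eq_norm, L1.norm_eq_integral_norm]
    refine lt_of_le_of_lt (le_trans (le_of_eq (integral_congr_ae ?_)) hgi) (half_lt_self hε)
    filter_upwards [Lp.coeFn_sub k (hg.toL1 g), hg.coeFn_toL1] with x h1 h2
    rw [h1, Pi.sub_apply, h2]
  have hcl : IsClosed {k : Lp ℂ 1 (volume : Measure ℝ) | p (convRep k)} :=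
    hp.preimage convL.continuous
  rwa [hcl.closure_eq] at hk

theorem isCompactOperator_ind_mul {G : L2R →L[ℂ] L2R} (hG : G ∈ groupCStar) (R : ℝ) :
    IsCompactOperator (mulOp (ind R) * G) := by
  refine convRep_dense_induction (p := fun G => IsCompactOperator (mulOp (ind R) * G))
    (isClosed_compact.preimage (by fun_prop)) (fun g hg hc hs => ?_) hG
  obtain ⟨r, hr⟩ := exists_support_bound hs
  -- The support bound r may be negative; passing to |r| ensures R ≤ R + |r|.
  have hr' : ∀ x, |r| < |x| → g x = 0 := fun x hx => hr x ((le_abs_self r).trans_lt hx)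
  rw [← ind_mul_convRep_mul_ind hg hr' R]
  have h := (isCompactOperator_ind_convRep_ind hg hc hs (R + |r|)).mul_left (mulOp (ind R))
  rwa [← mul_assoc, ← mul_assoc, mulOp_congr_mul_eq (bdd_ind R) (bdd_ind _) fun x => ?_] at h
  rcases le_or_gt |x| R with hx | hx
  · rw [ind_of_le (R := R + |r|) (hx.trans (by linarith [abs_nonneg r])), mul_one]
  · rw [ind_of_lt hx, zero_mul]

theorem isCompactOperator_mulOp_mul {f : ℝ → ℂ} (hf : Bdd f)
    (h0 : ∀ ε > 0, ∃ R, ∀ x, R < |x| → ‖f x‖ ≤ ε) {G : L2R →L[ℂ] L2R} (hG : G ∈ groupCStar) :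
    IsCompactOperator (mulOp f * G) := by
  have hmem : mulOp f * G ∈ closure {T : L2R →L[ℂ] L2R | IsCompactOperator T} := by
    rw [Metric.mem_closure_iff]
    intro ε hε
    obtain ⟨R, hR⟩ := h0 (ε / 2 / (‖G‖ + 1)) (by positivity)
    refine ⟨mulOp f * (mulOp (ind R) * G), (isCompactOperator_ind_mul hG R).mul_left _, ?_⟩
    rw [dist_eq_norm, ← mul_assoc, mulOp_mul hf (bdd_ind R), ← sub_mul,
      mulOp_sub hf (hf.mul (bdd_ind R))]
    have h1 : ‖mulOp fun x => f x - f x * ind R x‖ ≤ ε / 2 / (‖G‖ + 1) := by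
      refine norm_mulOp_le _ fun x => ?_
      rcases le_or_gt |x| R with hx | hx
      · rw [ind_of_le hx, mul_one, sub_self, norm_zero]
        positivity
      · rw [ind_of_lt hx, mul_zero, sub_zero]
        exact hR x hx
    calc _ ≤ ε / 2 / (‖G‖ + 1) * ‖G‖ := (norm_mul_le _ _).trans (by gcongr)
      _ < ε / 2 / (‖G‖ + 1) * (‖G‖ + 1) := by gcongr; linarith
      _ = ε / 2 := by field_simp
      _ < ε := half_lt_self hε
  rwa [isClosed_compact.closure_eq] at hmem

/-! ### Commutators with slowly varying functions -/

/-- `ψ` is slowly varying at `+∞`: its local oscillation tends to zero there. -/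
def SlowlyVarying (ψ : ℝ → ℂ) : Prop :=
  ∀ r : ℝ, ∀ ε > 0, ∃ R : ℝ, ∀ x, R < x → ∀ t, |t| ≤ r → ‖ψ x - ψ (x - t)‖ ≤ ε

/-- The commutator of M(ψ) with λ(g) is the integral of g(t) M(ψ - ψ(· - t)) λ_t, so its norm is
controlled by the oscillation of ψ at the scale of the support of g. -/
theorem norm_mulOp_mul_commutator_le {F ψ : ℝ → ℂ} (hF : Bdd F) (hψ : Bdd ψ)
    (g : Lp ℂ 1 (volume : Measure ℝ)) {C : ℝ}
    (h : ∀ᵐ t, g t ≠ 0 → ∀ x, ‖F x * (ψ x - ψ (x - t))‖ ≤ C) (hC : 0 ≤ C) :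
    ‖mulOp F * (mulOp ψ * convRep g - convRep g * mulOp ψ)‖ ≤ C * ‖g‖ := by
  refine ContinuousLinearMap.opNorm_le_bound _ (by positivity) fun ξ => ?_
  have h1 := mul_convRep_mul_apply (mulOp F * mulOp ψ) 1 g ξ
  have h2 := mul_convRep_mul_apply (mulOp F) (mulOp ψ) g ξ
  have i1 := (mulOp F * mulOp ψ).integrable_comp (integrable_smul_trOp g ξ)
  have i2 := (mulOp F).integrable_comp (integrable_smul_trOp g (mulOp ψ ξ))
  simp only [map_smul] at i1 i2
  simp only [mul_one] at h1
  simp only [mul_apply_eq_comp] at h1 h2 i1 i2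
  rw [mul_sub, ← mul_assoc, ← mul_assoc, sub_apply]
  simp only [mul_apply_eq_comp]
  rw [h1, h2, ← integral_sub i1 i2, L1.norm_eq_integral_norm, ← integral_const_mul,
    ← integral_mul_const]
  refine (norm_integral_le_integral_norm _).trans (integral_mono_of_nonneg
    (Eventually.of_forall fun _ => norm_nonneg _)
    (((L1.integrable_coeFn g).norm.const_mul C).mul_const _) ?_)
  filter_upwards [h] with t ht
  have hψt : Bdd fun x => ψ (x - t) := hψ.comp (measurable_sub_const t)
  have h3 : (mulOp F) (mulOp ψ (trOp t ξ)) - mulOp F (trOp t (mulOp ψ ξ)) =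
      (mulOp fun x => F x * (ψ x - ψ (x - t))) (trOp t ξ) := by
    rw [← map_sub, ← mul_apply_eq_comp (trOp t), trOp_mul_mulOp hψ, mul_apply_eq_comp,
      ← sub_apply, mulOp_sub hψ hψt, ← mul_apply_eq_comp (mulOp F), mulOp_mul hF (hψ.sub hψt)]
  rw [← smul_sub, h3, norm_smul]
  by_cases hg : g t = 0
  · simp [hg]
  · have h4 : ‖trOp t ξ‖ = ‖ξ‖ := (translation t).norm_map ξ
    have h5 := (mulOp fun x => F x * (ψ x - ψ (x - t))).le_of_opNorm_le
      (norm_mulOp_le _ (ht hg)) (trOp t ξ)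
    rw [h4] at h5
    calc ‖g t‖ * _ ≤ ‖g t‖ * (C * ‖ξ‖) := by gcongr
      _ = C * ‖g t‖ * ‖ξ‖ := by ring

/-- The part over a bounded window is compact. Outside it the norm is small: on the left because f
is, on the right because ψ hardly varies. -/
theorem isCompactOperator_mul_commutator {f ψ : ℝ → ℂ} (hf : Bdd f) (hψ : Bdd ψ)
    (h0 : ∀ ε > 0, ∃ R : ℝ, ∀ x, x < -R → ‖f x‖ ≤ ε) (hs : SlowlyVarying ψ)
    {G : L2R →L[ℂ] L2R} (hG : G ∈ groupCStar) :
    IsCompactOperator (mulOp f * (mulOp ψ * G - G * mulOp ψ)) := by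
  refine convRep_dense_induction
    (p := fun G => IsCompactOperator (mulOp f * (mulOp ψ * G - G * mulOp ψ)))
    (isClosed_compact.preimage (f := fun G => mulOp f * (mulOp ψ * G - G * mulOp ψ))
      (by fun_prop)) (fun g hg hc hgs => ?_) hG
  obtain ⟨r, hr⟩ := exists_support_bound hgs
  obtain ⟨C, hC⟩ := hf.bound
  obtain ⟨D, hD⟩ := hψ.bound
  have hC0 : 0 ≤ C := (norm_nonneg _).trans (hC 0)
  have hD0 : 0 ≤ D := (norm_nonneg _).trans (hD 0)
  set k := hg.toL1 g with hk
  have hmem : mulOp f * (mulOp ψ * convRep k - convRep k * mulOp ψ) ∈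
      closure {T : L2R →L[ℂ] L2R | IsCompactOperator T} := by
    rw [Metric.mem_closure_iff]
    intro ε hε
    -- The right tail is bounded by C * δ and the left tail by δ * (2 * D); one constant covers
    -- both.
    obtain ⟨δ, hδ0, hδ⟩ : ∃ δ > 0, (C + 2 * D) * δ * ‖k‖ < ε := by
      refine ⟨ε / ((C + 2 * D) * ‖k‖ + 1), by positivity, ?_⟩
      rw [mul_right_comm, mul_div_assoc', div_lt_iff₀ (by positivity)]
      nlinarith
    obtain ⟨R₁, hR₁⟩ := h0 δ hδ0
    obtain ⟨R₂, hR₂⟩ := hs r δ hδ0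
    let R := max R₁ R₂
    have hfR : Bdd fun x => f x * ind R x := hf.mul (bdd_ind R)
    refine ⟨(mulOp fun x => f x * ind R x) * (mulOp ψ * convRep k - convRep k * mulOp ψ), ?_, ?_⟩
    · have hz : ∀ h : ℝ → ℂ, (∀ x, R < |x| → h x = 0) →
          ∀ ε > 0, ∃ R, ∀ x, R < |x| → ‖h x‖ ≤ ε := fun h hh ε hε =>
        ⟨R, fun x hx => by rw [hh x hx, norm_zero]; exact hε.le⟩
      rw [mul_sub, ← mul_assoc, ← mul_assoc, mulOp_mul hfR hψ]
      refine IsCompactOperator.sub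
        (isCompactOperator_mulOp_mul (hfR.mul hψ) (hz _ fun x hx => ?_) (convRep_mem k))
        ((isCompactOperator_mulOp_mul hfR (hz _ fun x hx => ?_) (convRep_mem k)).mul_right _)
      · simp [ind_of_lt hx]
      · simp [ind_of_lt hx]
    · rw [dist_eq_norm, ← sub_mul, mulOp_sub hf hfR]
      refine lt_of_le_of_lt (norm_mulOp_mul_commutator_le (hf.sub hfR) hψ k (C := (C + 2 * D) * δ)
        ?_ (by positivity)) hδ
      filter_upwards [hg.coeFn_toL1] with t ht hne x
      rw [hk, ht] at hne
      have htr : |t| ≤ r := not_lt.mp fun h => hne (hr t h)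
      have h2D : ‖ψ x - ψ (x - t)‖ ≤ 2 * D :=
        (norm_sub_le _ _).trans (by linarith [hD x, hD (x - t)])
      rw [norm_mul]
      rcases le_or_gt |x| R with hx | hx
      · rw [ind_of_le hx, mul_one, sub_self, norm_zero, zero_mul]
        positivity
      · rw [ind_of_lt hx, mul_zero, sub_zero]
        rcases lt_abs.mp hx with hx | hx
        · calc _ ≤ C * δ := by
                gcongr
                · exact hC x
                · exact hR₂ x ((le_max_right _ _).trans_lt hx) t htr
            _ ≤ (C + 2 * D) * δ := by gcongr; linarith
        · calc _ ≤ δ * (2 * D) := by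
                gcongr
                refine hR₁ x ?_
                have := le_max_left R₁ R₂
                change R < -x at hx
                linarith
            _ ≤ (C + 2 * D) * δ := by nlinarith
  rwa [isClosed_compact.closure_eq] at hmem

/-! ### The symbol at `+∞` -/

theorem isClosed_tendsto_inner {H ι : Type*} [NormedAddCommGroup H] [InnerProductSpace ℂ H]
    {l : Filter ι} {v : ι → H} {C : ℝ} (hv : ∀ i, ‖v i‖ ≤ C) :
    IsClosed {x : H | Tendsto (fun i => inner ℂ x (v i)) l (𝓝 0)} := by
  refine isClosed_of_closure_subset fun x hx => ?_
  rw [Metric.mem_closure_iff] at hx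
  rw [Set.mem_ofPred_eq, Metric.tendsto_nhds]
  intro ε hε
  obtain ⟨y, hy, hxy⟩ := hx (ε / 2 / (|C| + 1)) (by positivity)
  filter_upwards [Metric.tendsto_nhds.mp hy (ε / 2) (by positivity)] with i hi
  rw [dist_zero_right] at hi ⊢
  have h1 : inner ℂ x (v i) = inner ℂ (x - y) (v i) + inner ℂ y (v i) := by
    rw [inner_sub_left, sub_add_cancel]
  have h2 : ‖(inner ℂ (x - y) (v i) : ℂ)‖ ≤ ε / 2 := by
    rw [dist_eq_norm] at hxy
    calc _ ≤ ‖x - y‖ * ‖v i‖ := norm_inner_le_norm _ _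
      _ ≤ ε / 2 / (|C| + 1) * (|C| + 1) := by
          gcongr
          exact (hv i).trans ((le_abs_self C).trans (by linarith))
      _ = ε / 2 := by field_simp
  rw [h1]
  refine (norm_add_le _ _).trans_lt ?_
  linarith

theorem exists_mulOp_ind_eq {ξ : L2R} {φ : ℝ → ℂ} (h : ξ =ᵐ[volume] φ) (hs : HasCompactSupport φ) :
    ∃ R, mulOp (ind R) ξ = ξ := by
  obtain ⟨R, hR⟩ := exists_support_bound hs
  refine ⟨R, Lp.ext ?_⟩
  filter_upwards [mulOp_coeFn (bdd_ind R) ξ, h] with x h1 h2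
  rw [h1, h2]
  rcases le_or_gt |x| R with hx | hx
  · rw [ind_of_le hx, one_mul]
  · rw [hR x hx, mul_zero]

theorem dense_hasCompactSupport :
    Dense {ξ : L2R | ∃ φ : ℝ → ℂ, ξ =ᵐ[volume] φ ∧ HasCompactSupport φ ∧ ContDiff ℝ ∞ φ} :=
  MeasureTheory.Lp.dense_hasCompactSupport_contDiff (by simp)

theorem norm_trOp_apply (t : ℝ) (ξ : L2R) : ‖trOp t ξ‖ = ‖ξ‖ := (translation t).norm_map ξ

theorem inner_trOp_right (t : ℝ) (x ξ : L2R) : inner ℂ x (trOp t ξ) = inner ℂ (trOp (-t) x) ξ := by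
  rw [← ContinuousLinearMap.adjoint_inner_left, ← ContinuousLinearMap.star_eq_adjoint, star_trOp]

theorem inner_mulOp_ind_trOp (x ξ : L2R) {R S t : ℝ} (ht : R + S < t) :
    inner ℂ (mulOp (ind R) x) (trOp t (mulOp (ind S) ξ)) = 0 := by
  rw [inner_mulOp_trOp (bdd_ind R) (bdd_ind S)]
  refine integral_eq_zero_of_ae (Eventually.of_forall fun y => ?_)
  rcases le_or_gt |y| R with hy | hy
  · have : S < |y - t| := by
      have := neg_abs_le (y - t)
      have := le_abs_self y
      linarith
    simp [ind_of_lt this]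
  · simp [ind_of_lt hy]

/-- Compactly supported vectors become orthogonal after a large translation; density, used in each
argument in turn, gives the rest. -/
theorem tendsto_inner_trOp (x ξ : L2R) :
    Tendsto (fun t => inner ℂ x (trOp t ξ)) atTop (𝓝 0) := by
  refine dense_hasCompactSupport.induction (P := fun x =>
    Tendsto (fun t => inner ℂ x (trOp t ξ)) atTop (𝓝 0)) ?_
    (isClosed_tendsto_inner (C := ‖ξ‖) fun t => (norm_trOp_apply t ξ).le) x
  rintro x ⟨φ, hxφ, hφ, -⟩
  obtain ⟨R, hR⟩ := exists_mulOp_ind_eq hxφ hφ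
  suffices h : Tendsto (fun t => inner ℂ ξ (trOp (-t) x)) atTop (𝓝 0) by
    have h1 := (Complex.continuous_conj.tendsto 0).comp h
    rw [map_zero] at h1
    refine h1.congr fun t => ?_
    rw [Function.comp_apply, inner_conj_symm, ← inner_trOp_right]
  refine dense_hasCompactSupport.induction (P := fun ξ =>
    Tendsto (fun t => inner ℂ ξ (trOp (-t) x)) atTop (𝓝 0)) ?_
    (isClosed_tendsto_inner (C := ‖x‖) fun t => (norm_trOp_apply (-t) x).le) ξ
  rintro ξ ⟨φ, hxφ, hφ, -⟩
  obtain ⟨S, hS⟩ := exists_mulOp_ind_eq hxφ hφ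
  refine tendsto_const_nhds.congr' ?_
  filter_upwards [eventually_gt_atTop (R + S)] with t ht
  rw [← inner_conj_symm, ← inner_trOp_right, ← hR, ← hS, inner_mulOp_ind_trOp x ξ ht, map_zero]

/-- Compare the matrix coefficients of T at λ_t η and λ_t ξ as t → +∞. The compact part disappears
because λ_t ξ tends weakly to 0. Since A commutes with λ_t, the rest is ⟨η, M(f(· + t)) A ξ⟩, which
tends to ⟨η, Aξ⟩ by dominated convergence. -/
theorem norm_le_of_isCompactOperator_sub {T A : L2R →L[ℂ] L2R} {f : ℝ → ℂ} (hf : Bdd f)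
    (hlim : Tendsto f atTop (𝓝 1)) (hA : ∀ t, A * trOp t = trOp t * A)
    (hc : IsCompactOperator (T - mulOp f * A)) : ‖A‖ ≤ ‖T‖ := by
  have key : ∀ η ξ : L2R, ‖(inner ℂ η (A ξ) : ℂ)‖ ≤ ‖η‖ * (‖T‖ * ‖ξ‖) := by
    intro η ξ
    obtain ⟨C, hC⟩ := hf.bound
    have hint : Integrable fun x => starRingEnd ℂ (η x) * A ξ x := by
      simpa [RCLike.inner_apply, mul_comm] using L2.integrable_inner (𝕜 := ℂ) η (A ξ)
    have h1 : Tendsto (fun t => inner ℂ (trOp t η) ((mulOp f * A) (trOp t ξ))) atTop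
        (𝓝 (inner ℂ η (A ξ))) := by
      have h2 : ∀ t, inner ℂ (trOp t η) ((mulOp f * A) (trOp t ξ)) =
          ∫ x, f (x + t) * (starRingEnd ℂ (η x) * A ξ x) := fun t => by
        rw [← mul_apply_eq_comp, mul_assoc, hA, ← mul_assoc, mulOp_mul_trOp hf, mul_assoc,
          mul_apply_eq_comp, trOp_apply, trOp_apply, LinearIsometry.inner_map_map,
          mul_apply_eq_comp, inner_mulOp (hf.comp (measurable_add_const t))]
      have h3 : inner ℂ η (A ξ) = ∫ x, 1 * (starRingEnd ℂ (η x) * A ξ x) := by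
        rw [L2.inner_def]
        simp only [RCLike.inner_apply, one_mul, mul_comm]
      simp only [h2]
      rw [h3]
      refine tendsto_integral_filter_of_dominated_convergence
        (fun x => C * ‖starRingEnd ℂ (η x) * A ξ x‖) ?_ ?_ (hint.norm.const_mul C) ?_
      · refine Eventually.of_forall fun t => ?_
        exact (hf.comp (measurable_add_const t)).meas.aestronglyMeasurable.mul
          hint.aestronglyMeasurable
      · refine Eventually.of_forall fun t => Eventually.of_forall fun x => ?_
        rw [norm_mul]
        gcongr
        exact hC _
      · refine Eventually.of_forall fun x => ?_
        exact (hlim.comp (tendsto_atTop_add_const_left _ x tendsto_id)).mul_const _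
    have h2 := hc.tendsto_inner (l := atTop) (v := fun t => trOp t ξ) (w := fun t => trOp t η)
      (C := max ‖ξ‖ ‖η‖) (fun t => (norm_trOp_apply t ξ).le.trans (le_max_left _ _))
      (fun t => (norm_trOp_apply t η).le.trans (le_max_right _ _)) (tendsto_inner_trOp · ξ)
    have h3 := (h2.add h1).norm
    rw [zero_add] at h3
    refine le_of_tendsto h3 (Eventually.of_forall fun t => ?_)
    rw [← inner_add_right, ← add_apply, sub_add_cancel]
    refine (norm_inner_le_norm _ _).trans ?_
    rw [norm_trOp_apply]
    gcongr
    refine (T.le_opNorm _).trans ?_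
    rw [norm_trOp_apply]
  refine ContinuousLinearMap.opNorm_le_bound _ (norm_nonneg _) fun ξ => ?_
  rcases eq_or_ne (A ξ) 0 with h | h
  · rw [h, norm_zero]
    positivity
  · have h1 := key (A ξ) ξ
    rw [inner_self_eq_norm_sq_to_K, norm_pow, RCLike.norm_ofReal, abs_norm, sq] at h1
    exact le_of_mul_le_mul_left h1 (norm_pos_iff.mpr h)

/-! ### Asymptotic convolution operators -/

/-- The piecewise linear cutoff function from `0` on `(-∞, 0]` to `1` on `[1, ∞)`. -/
def chi (x : ℝ) : ℂ := ((max 0 (min x 1) : ℝ) : ℂ)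

theorem continuous_chi : Continuous chi := by
  unfold chi
  fun_prop

theorem chi_of_nonpos {x : ℝ} (h : x ≤ 0) : chi x = 0 := by
  rw [chi, max_eq_left ((min_le_left _ _).trans h), Complex.ofReal_zero]

theorem chi_of_one_le {x : ℝ} (h : 1 ≤ x) : chi x = 1 := by
  rw [chi, min_eq_right h, max_eq_right zero_le_one, Complex.ofReal_one]

theorem bdd_chi : Bdd chi := by
  refine ⟨continuous_chi.measurable, 1, fun x => ?_⟩
  rw [chi, Complex.norm_real, Real.norm_of_nonneg (le_max_left _ _)]
  exact max_le zero_le_one (min_le_right _ _)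

theorem tendsto_chi : Tendsto chi atTop (𝓝 1) :=
  tendsto_const_nhds.congr' <| by
    filter_upwards [eventually_ge_atTop 1] with x hx
    rw [chi_of_one_le hx]

theorem star_mulOp_chi : star (mulOp chi) = mulOp chi := by
  rw [star_mulOp bdd_chi]
  congr 1
  ext x
  rw [chi, Complex.conj_ofReal]

theorem slowlyVarying_chi : SlowlyVarying chi := fun r ε hε => by
  refine ⟨1 + |r|, fun x hx t ht => ?_⟩
  have h1 := le_abs_self t
  have h2 := le_abs_self r
  have h3 := abs_nonneg r
  rw [chi_of_one_le (by linarith), chi_of_one_le (by linarith), sub_self, norm_zero]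
  exact hε.le

theorem isCompactOperator_chi_commutator {ψ : ℝ → ℂ} (hψ : Bdd ψ) (hs : SlowlyVarying ψ)
    {G : L2R →L[ℂ] L2R} (hG : G ∈ groupCStar) :
    IsCompactOperator (mulOp chi * (mulOp ψ * G - G * mulOp ψ)) := by
  refine isCompactOperator_mul_commutator bdd_chi hψ (fun ε hε => ⟨0, fun x hx => ?_⟩) hs hG
  rw [chi_of_nonpos (by linarith), norm_zero]
  exact hε.le

theorem isCompactOperator_chi_sq {G : L2R →L[ℂ] L2R} (hG : G ∈ groupCStar) :
    IsCompactOperator (mulOp chi * mulOp chi * G - mulOp chi * G) := by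
  rw [mulOp_mul bdd_chi bdd_chi, ← sub_mul, mulOp_sub (bdd_chi.mul bdd_chi) bdd_chi]
  refine isCompactOperator_mulOp_mul ((bdd_chi.mul bdd_chi).sub bdd_chi)
    (fun ε hε => ⟨1, fun x hx => ?_⟩) hG
  suffices h : chi x * chi x - chi x = 0 by
    rw [h, norm_zero]
    exact hε.le
  rcases lt_abs.mp hx with h | h
  · rw [chi_of_one_le h.le]
    ring
  · rw [chi_of_nonpos (by linarith)]
    ring

/-- The commutator estimate needs a left factor that is small at -∞, so it only gives χ[χ, G]. Since
χ²G and χG agree modulo compacts, χG is congruent to χGχ; the adjoint of this relation for G* shows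
that Gχ is congruent to χGχ as well. -/
theorem isCompactOperator_commutator_chi {G : L2R →L[ℂ] L2R} (hG : G ∈ groupCStar) :
    IsCompactOperator (mulOp chi * G - G * mulOp chi) := by
  set c := mulOp chi with hc
  have hst : star c = c := star_mulOp_chi
  have h1 : IsCompactOperator (c * (c * G - G * c)) :=
    isCompactOperator_chi_commutator bdd_chi slowlyVarying_chi hG
  have h2 : IsCompactOperator (c * c * G - c * G) := isCompactOperator_chi_sq hG
  have h3 : IsCompactOperator (c * (c * star G - star G * c)) :=
    isCompactOperator_chi_commutator bdd_chi slowlyVarying_chi (star_mem hG)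
  have h4 : IsCompactOperator (c * c * star G - c * star G) := isCompactOperator_chi_sq (star_mem hG)
  have h5 := IsCompactOperator.star_clm
    (T := c * (c * star G - star G * c) - (c * c * star G - c * star G)) (h3.sub h4)
  have e : c * G - G * c = c * (c * G - G * c) - (c * c * G - c * G) -
      star (c * (c * star G - star G * c) - (c * c * star G - c * star G)) := by
    simp only [star_sub, star_mul, star_star, hst]
    noncomm_ring
  rw [e]
  exact (h1.sub h2).sub h5

theorem isClosed_groupCStar : IsClosed (groupCStar : Set (L2R →L[ℂ] L2R)) :=
  NonUnitalStarSubalgebra.isClosed_topologicalClosure _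

/-- The operators that agree with `M(χ) G`, for some `G ∈ λ(C*(ℝ))`, up to a compact operator. -/
def asymptoticConv : NonUnitalStarSubalgebra ℂ (L2R →L[ℂ] L2R) where
  carrier := {T | ∃ G ∈ groupCStar, IsCompactOperator (T - mulOp chi * G)}
  zero_mem' := ⟨0, zero_mem _, by simpa using isCompactOperator_zero⟩
  add_mem' := by
    rintro S T ⟨G, hG, hS⟩ ⟨H, hH, hT⟩
    refine ⟨G + H, add_mem hG hH, ?_⟩
    have e : S + T - mulOp chi * (G + H) = (S - mulOp chi * G) + (T - mulOp chi * H) := by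
      noncomm_ring
    rw [e]
    exact hS.add hT
  smul_mem' := by
    rintro a T ⟨G, hG, hT⟩
    refine ⟨a • G, SMulMemClass.smul_mem a hG, ?_⟩
    rw [mul_smul_comm, ← smul_sub]
    exact hT.smul a
  mul_mem' := by
    rintro S T ⟨G, hG, hS⟩ ⟨H, hH, hT⟩
    refine ⟨G * H, mul_mem hG hH, ?_⟩
    -- Modulo compacts, ST becomes χGχH, then χ²GH by the commutator, then χGH.
    have e : S * T - mulOp chi * (G * H) = (S - mulOp chi * G) * T +
        mulOp chi * G * (T - mulOp chi * H) - mulOp chi * (mulOp chi * G - G * mulOp chi) * H +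
        (mulOp chi * mulOp chi * G - mulOp chi * G) * H := by
      noncomm_ring
    rw [e]
    exact (((hS.mul_right T).add (hT.mul_left _)).sub ((isCompactOperator_chi_commutator bdd_chi
      slowlyVarying_chi hG).mul_right H)).add ((isCompactOperator_chi_sq hG).mul_right H)
  star_mem' := by
    rintro T ⟨G, hG, hT⟩
    refine ⟨star G, star_mem hG, ?_⟩
    have e : star T - mulOp chi * star G =
        star (T - mulOp chi * G) - (mulOp chi * star G - star G * mulOp chi) := by
      rw [star_sub, star_mul, star_mulOp_chi]
      noncomm_ring
    rw [e]
    exact hT.star_clm.sub (isCompactOperator_commutator_chi (star_mem hG))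

theorem mem_asymptoticConv {T : L2R →L[ℂ] L2R} :
    T ∈ asymptoticConv ↔ ∃ G ∈ groupCStar, IsCompactOperator (T - mulOp chi * G) := Iff.rfl

/-- The symbol map does not increase norms, so the symbols of a convergent sequence are Cauchy;
their limit is the symbol of the limit. -/
theorem isClosed_asymptoticConv : IsClosed (asymptoticConv : Set (L2R →L[ℂ] L2R)) := by
  refine isClosed_of_closure_subset fun T hT => ?_
  obtain ⟨S, hS, hlim⟩ := mem_closure_iff_seq_limit.mp hT
  choose G hG hc using fun n => mem_asymptoticConv.mp (hS n)
  have hle : ∀ m n, dist (G m) (G n) ≤ dist (S m) (S n) := fun m n => by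
    rw [dist_eq_norm, dist_eq_norm]
    refine norm_le_of_isCompactOperator_sub bdd_chi tendsto_chi
      (mul_trOp_of_mem (sub_mem (hG m) (hG n))) ?_
    have e : S m - S n - mulOp chi * (G m - G n) =
        (S m - mulOp chi * G m) - (S n - mulOp chi * G n) := by
      noncomm_ring
    rw [e]
    exact (hc m).sub (hc n)
  have hcau : CauchySeq G := by
    rw [Metric.cauchySeq_iff]
    intro ε hε
    obtain ⟨N, hN⟩ := Metric.cauchySeq_iff.mp hlim.cauchySeq ε hε
    exact ⟨N, fun m hm n hn => (hle m n).trans_lt (hN m hm n hn)⟩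
  obtain ⟨G₀, hG₀⟩ := cauchySeq_tendsto_of_complete hcau
  refine ⟨G₀, isClosed_groupCStar.mem_of_tendsto hG₀ (Eventually.of_forall hG), ?_⟩
  exact isClosed_compact.mem_of_tendsto (hlim.sub (hG₀.const_mul (mulOp chi)))
    (Eventually.of_forall hc)

/-! ### Functions on `(-∞, +∞]` -/

/-- The point `+∞` of `(-∞, +∞]`. -/
def topPt : ExtLine := ⟨⊤, Set.mem_Ioi.mpr bot_lt_top⟩

theorem tendsto_restrict_atTop (f : C₀(ExtLine, ℂ)) :
    Tendsto (fun x : ℝ => f (toExtLine x)) atTop (𝓝 (f topPt)) := by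
  have h : Tendsto toExtLine atTop (𝓝 topPt) := by
    rw [tendsto_subtype_rng]
    change Tendsto (fun x : ℝ => (x : EReal)) atTop (𝓝 ⊤)
    exact EReal.tendsto_coe_nhds_top_iff.mpr tendsto_id
  exact ((map_continuous f).tendsto topPt).comp h

theorem tendsto_restrict_atBot (f : C₀(ExtLine, ℂ)) :
    Tendsto (fun x : ℝ => f (toExtLine x)) atBot (𝓝 0) := by
  refine f.zero_at_infty'.comp ?_
  rw [hasBasis_cocompact.tendsto_right_iff]
  intro K hK
  rcases K.eq_empty_or_nonempty with rfl | hne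
  · simp
  -- A nonempty compact subset of (-∞, +∞] has a least element, which lies above -∞, so reals near
  -- -∞ are outside it.
  obtain ⟨m, ⟨p, hp, rfl⟩, hm⟩ :=
    (hK.image continuous_subtype_val).exists_isLeast (hne.image _)
  have h : Tendsto (fun x : ℝ => (x : EReal)) atBot (𝓝 ⊥) :=
    EReal.tendsto_coe_nhds_bot_iff.mpr tendsto_id
  filter_upwards [h.eventually (Iio_mem_nhds p.2)] with x hx hxK
  exact (hm ⟨_, hxK, rfl⟩).not_gt hx

/-- Clamping to [-R, R] is continuous on all of (-∞, +∞] and does not change φ, so composing φ with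
it extends φ. -/
theorem exists_extension {φ : ℝ → ℂ} (hφ : Continuous φ) {R : ℝ} (hR : 0 ≤ R)
    (hleft : ∀ x ≤ -R, φ x = 0) (hright : ∀ x ≥ R, φ x = φ R) :
    ∃ F : C₀(ExtLine, ℂ), ∀ x, F (toExtLine x) = φ x := by
  have hmem : ∀ x : EReal, max ((-R : ℝ) : EReal) (min x (R : ℝ)) ∈ ({⊥, ⊤}ᶜ : Set EReal) := fun x => by
    simp only [Set.mem_compl_iff, Set.mem_insert_iff, Set.mem_singleton_iff, not_or]
    constructor
    · exact ((EReal.bot_lt_coe _).trans_le (le_max_left _ _)).ne'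
    · exact (max_lt (EReal.coe_lt_top _) ((min_le_right _ _).trans_lt (EReal.coe_lt_top _))).ne
  let κ : ExtLine → ℝ := fun x => (max ((-R : ℝ) : EReal) (min (x : EReal) (R : ℝ))).toReal
  have hκ : Continuous κ := EReal.continuousOn_toReal.comp_continuous (by fun_prop) fun x => hmem x
  have hκ' : ∀ x : ℝ, κ (toExtLine x) = max (-R) (min x R) := fun x => by
    simp only [κ, toExtLine]
    have hm := EReal.coe_strictMono.monotone
    rw [← hm.map_min, ← hm.map_max, EReal.toReal_coe]
  refine ⟨⟨⟨fun x => φ (κ x), hφ.comp hκ⟩, ?_⟩, fun x => ?_⟩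
  · refine tendsto_const_nhds.congr' ?_
    have hc : IsCompact {x : ExtLine | ((-R : ℝ) : EReal) ≤ x} := by
      rw [Subtype.isCompact_iff]
      have : ((↑) : ExtLine → EReal) '' {x : ExtLine | ((-R : ℝ) : EReal) ≤ x} =
          Set.Icc ((-R : ℝ) : EReal) ⊤ := by
        ext x
        constructor
        · rintro ⟨y, hy, rfl⟩
          exact Set.mem_Icc.mpr ⟨hy, le_top⟩
        · intro hx
          exact ⟨⟨x, Set.mem_Ioi.mpr ((EReal.bot_lt_coe _).trans_le (Set.mem_Icc.mp hx).1)⟩,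
            (Set.mem_Icc.mp hx).1, rfl⟩
      rw [this]
      exact isCompact_Icc
    filter_upwards [hc.compl_mem_cocompact] with x hx
    have hx' : (x : EReal) < ((-R : ℝ) : EReal) := not_le.mp hx
    have : κ x = -R := by
      simp only [κ]
      rw [max_eq_left ((min_le_left _ _).trans hx'.le), EReal.toReal_coe]
    change 0 = φ (κ x)
    rw [this, hleft _ le_rfl]
  · change φ (κ (toExtLine x)) = φ x
    rw [hκ']
    rcases le_total x (-R) with h1 | h1
    · rw [max_eq_left ((min_le_left _ _).trans h1), hleft _ le_rfl, hleft _ h1]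
    rcases le_total x R with h2 | h2
    · rw [min_eq_left h2, max_eq_right h1]
    · rw [min_eq_right h2, max_eq_right (by linarith), hright x h2]

theorem mulRep_mul_mem (f : C₀(ExtLine, ℂ)) {G : L2R →L[ℂ] L2R} (hG : G ∈ groupCStar) :
    mulRep f * G ∈ wienerHopf :=
  NonUnitalStarSubalgebra.le_topologicalClosure _
    (NonUnitalStarAlgebra.subset_adjoin ℂ _ ⟨f, G, hG, rfl⟩)

theorem isClosed_wienerHopf : IsClosed (wienerHopf : Set (L2R →L[ℂ] L2R)) :=
  NonUnitalStarSubalgebra.isClosed_topologicalClosure _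

/-- On a generator M(f)G the symbol is f(+∞)G, because f - f(+∞)χ vanishes at both ends. -/
theorem wienerHopf_le_asymptoticConv : wienerHopf ≤ asymptoticConv := by
  refine NonUnitalStarSubalgebra.topologicalClosure_minimal _
    (NonUnitalStarAlgebra.adjoin_le ?_) isClosed_asymptoticConv
  rintro _ ⟨f, G, hG, rfl⟩
  refine ⟨f topPt • G, SMulMemClass.smul_mem _ hG, ?_⟩
  have hb := bdd_restrict f
  have hc : Bdd fun x => f topPt * chi x := (Bdd.const _).mul bdd_chi
  have e : mulRep f * G - mulOp chi * (f topPt • G) =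
      (mulOp fun x => f (toExtLine x) - f topPt * chi x) * G := by
    rw [← mulOp_sub hb hc, sub_mul, mulRep_eq_mulOp, ← mulOp_mul (Bdd.const _) bdd_chi, mulOp_const,
      smul_mul_assoc, smul_mul_assoc, one_mul, mul_smul_comm]
  rw [e]
  refine isCompactOperator_mulOp_mul (hb.sub hc) (fun ε hε => ?_) hG
  have h1 : Tendsto (fun x => f (toExtLine x) - f topPt * chi x) atTop (𝓝 0) := by
    simpa using (tendsto_restrict_atTop f).sub (tendsto_chi.const_mul (f topPt))
  have h2 : Tendsto (fun x => f (toExtLine x) - f topPt * chi x) atBot (𝓝 0) := by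
    have h3 : Tendsto chi atBot (𝓝 0) := tendsto_const_nhds.congr' <| by
      filter_upwards [eventually_le_atBot 0] with x hx
      rw [chi_of_nonpos hx]
    simpa using (tendsto_restrict_atBot f).sub (h3.const_mul (f topPt))
  obtain ⟨A, hA⟩ := eventually_atTop.mp ((Metric.tendsto_nhds.mp h1) ε hε)
  obtain ⟨B, hB⟩ := eventually_atBot.mp ((Metric.tendsto_nhds.mp h2) ε hε)
  refine ⟨max A (-B), fun x hx => ?_⟩
  have h3 := le_max_left A (-B)
  have h4 := le_max_right A (-B)
  rw [← dist_zero_right]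
  rcases lt_abs.mp hx with hx | hx
  · exact (hA x (by linarith)).le
  · exact (hB x (by linarith)).le

/-! ### Compact operators belong to the Wiener–Hopf algebra -/

theorem mulOp_mul_mem_of_compactSupport {φ : ℝ → ℂ} (hφ : Continuous φ) {R : ℝ}
    (hR : ∀ x, R < |x| → φ x = 0) {G : L2R →L[ℂ] L2R} (hG : G ∈ groupCStar) :
    mulOp φ * G ∈ wienerHopf := by
  have h0 := le_abs_self R
  obtain ⟨F, hF⟩ := exists_extension hφ (R := |R| + 1) (by positivity)
    (fun x hx => hR x (by have := neg_le_abs x; linarith)) fun x hx => by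
      have := abs_nonneg R
      rw [hR x (by have := le_abs_self x; linarith),
        hR _ (by rw [abs_of_pos (by linarith)]; linarith)]
  have := mulRep_mul_mem F hG
  rwa [mulRep_eq_mulOp, funext hF] at this

theorem ind_mul_convRep_indL1 (R r : ℝ) :
    mulOp (ind R) * convRep (indL1 r) * mulOp (ind (R + r)) = mulOp (ind R) * convRep (indL1 r) :=
  ind_mul_convRep_mul_ind (integrable_ind r) (fun _ h => ind_of_lt h) R

theorem mulOp_indL2 {φ : ℝ → ℂ} (hφ : Bdd φ) {R : ℝ} (hR : ∀ x, R < |x| → φ x = 0) :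
    mulOp φ (indL2 R) =ᵐ[volume] φ := by
  filter_upwards [mulOp_coeFn hφ (indL2 R), (memLp_ind 2 R).coeFn_toLp] with x h1 h2
  rw [h1, indL2, h2]
  rcases le_or_gt |x| R with hx | hx
  · rw [ind_of_le hx, mul_one]
  · rw [hR x hx, zero_mul]

theorem integral_ind {R : ℝ} (hR : 0 ≤ R) : ∫ x, ind R x = ((2 * R : ℝ) : ℂ) := by
  rw [show (fun x => ind R x) = (Set.Icc (-R) R).indicator fun _ => (1 : ℂ) from rfl,
    integral_indicator measurableSet_Icc]
  simp only [integral_const, MeasurableSet.univ, measureReal_restrict_apply, Set.univ_inter,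
    Real.volume_real_Icc]
  rw [max_eq_left (by linarith), Complex.real_smul, mul_one, sub_neg_eq_add, two_mul]

theorem ind_mul_convRep_indL2 (R : ℝ) :
    (mulOp (ind R) * convRep (indL1 1)) (indL2 (R + 1)) = (2 : ℂ) • mulOp (ind R) (indL2 (R + 1)) := by
  have h := mul_convRep_mul_apply (mulOp (ind R)) 1 (indL1 1) (indL2 (R + 1))
  simp only [mul_one] at h
  have h2 : (2 : ℂ) = ∫ x, ind 1 x := by
    rw [integral_ind zero_le_one]
    norm_num
  rw [h, h2, ← integral_smul_const]
  refine integral_congr_ae ?_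
  filter_upwards [(integrable_ind 1).coeFn_toL1] with t ht
  rw [indL1, ht]
  rcases le_or_gt |t| 1 with h1 | h1
  · congr 1
    refine Lp.ext ?_
    rw [mul_apply_eq_comp, trOp_apply]
    filter_upwards [mulOp_coeFn (bdd_ind R) (translation t (indL2 (R + 1))),
      mulOp_coeFn (bdd_ind R) (indL2 (R + 1)), translation_coeFn t (indL2 (R + 1)),
      (memLp_ind 2 (R + 1)).coeFn_toLp, ae_comp_sub (memLp_ind 2 (R + 1)).coeFn_toLp t]
      with x g1 g2 g3 g4 g5
    rw [g1, g2, g3, indL2, g4, g5]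
    rcases le_or_gt |x| R with hx | hx
    · rw [ind_of_le (R := R + 1) (x := x) (by linarith),
        ind_of_le (R := R + 1) ((abs_sub _ _).trans (add_le_add hx h1))]
    · rw [ind_of_lt hx, zero_mul, zero_mul]
  · rw [ind_of_lt h1, zero_smul, zero_smul]

/-- In a product of one generator with the adjoint A* of another, the functions φ and θ localize
both sides. The convolution by a wide indicator in between then becomes the rank-one operator of v,
and the product is the rank-one operator of φv = ξ and Av = 2η. -/
theorem rankOne_mem_of_compactSupport {φ θ : ℝ → ℂ} (hφ : Continuous φ) (hθ : Continuous θ)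
    (hφs : HasCompactSupport φ) (hθs : HasCompactSupport θ) {ξ η : L2R} (hξ : ξ =ᵐ[volume] φ)
    (hη : η =ᵐ[volume] θ) : InnerProductSpace.rankOne ℂ ξ η ∈ wienerHopf := by
  obtain ⟨R₁, hR₁⟩ := exists_support_bound hφs
  obtain ⟨R₂, hR₂⟩ := exists_support_bound hθs
  set R := max R₁ R₂ with hR
  have hφR : ∀ x, R < |x| → φ x = 0 := fun x hx => hR₁ x ((le_max_left _ _).trans_lt hx)
  have hθR : ∀ x, R < |x| → θ x = 0 := fun x hx => hR₂ x ((le_max_right _ _).trans_lt hx)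
  have hφR' : ∀ x, R + 1 < |x| → φ x = 0 := fun x hx => hφR x (by linarith)
  have hθR' : ∀ x, R + 1 < |x| → θ x = 0 := fun x hx => hθR x (by linarith)
  have bφ : Bdd φ := ⟨hφ.measurable, hφ.bounded_above_of_compact_support hφs⟩
  have bθ : Bdd θ := ⟨hθ.measurable, hθ.bounded_above_of_compact_support hθs⟩
  have eφ : mulOp φ (indL2 (R + 1)) = ξ := Lp.ext ((mulOp_indL2 bφ hφR').trans hξ.symm)
  have eθ : mulOp θ (indL2 (R + 1)) = η := Lp.ext ((mulOp_indL2 bθ hθR').trans hη.symm)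
  have pφ : mulOp φ * mulOp (ind (R + 1)) = mulOp φ :=
    mulOp_congr_mul_eq bφ (bdd_ind _) fun x => by
      rcases le_or_gt |x| (R + 1) with hx | hx
      · rw [ind_of_le hx, mul_one]
      · rw [hφR' x hx, zero_mul]
  have pθ : mulOp θ * mulOp (ind R) = mulOp θ :=
    mulOp_congr_mul_eq bθ (bdd_ind _) fun x => by
      rcases le_or_gt |x| R with hx | hx
      · rw [ind_of_le hx, mul_one]
      · rw [hθR x hx, zero_mul]
  set v := indL2 (R + 1)
  let A : L2R →L[ℂ] L2R := mulOp θ * convRep (indL1 1)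
  have hA : A ∈ wienerHopf := mulOp_mul_mem_of_compactSupport hθ hθR (convRep_mem _)
  have hB := mul_mem (mulOp_mul_mem_of_compactSupport hφ hφR (convRep_mem (indL1 (2 * (R + 1)))))
    (star_mem hA)
  have hAv : A v = (2 : ℂ) • η := by
    have h1 : A = mulOp θ * (mulOp (ind R) * convRep (indL1 1)) := by
      rw [← mul_assoc, pθ]
    rw [h1, mul_apply_eq_comp, ind_mul_convRep_indL2, map_smul, ← mul_apply_eq_comp, pθ, eθ]
  -- Finite propagation of A provides the right-hand cutoff needed around the wide indicator.
  have hA' : A = A * mulOp (ind (R + 1)) := by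
    have h1 : A = mulOp θ * (mulOp (ind R) * convRep (indL1 1)) := by
      rw [← mul_assoc, pθ]
    conv_lhs => rw [h1, ← ind_mul_convRep_indL1, ← mul_assoc, ← mul_assoc, pθ]
  have hB' : mulOp φ * convRep (indL1 (2 * (R + 1))) * star A =
      InnerProductSpace.rankOne ℂ ξ ((2 : ℂ) • η) := by
    rw [hA', star_mul, star_mulOp_ind, ← pφ]
    have h1 : mulOp φ * mulOp (ind (R + 1)) * convRep (indL1 (2 * (R + 1))) *
        (mulOp (ind (R + 1)) * star A) = mulOp φ * (mulOp (ind (R + 1)) *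
          convRep (indL1 (2 * (R + 1))) * mulOp (ind (R + 1))) * star A := by
      simp only [mul_assoc]
    rw [h1, ind_mul_convRep_indL1_mul_ind le_rfl, ContinuousLinearMap.mul_def,
      ContinuousLinearMap.mul_def, InnerProductSpace.comp_rankOne, InnerProductSpace.rankOne_comp,
      ContinuousLinearMap.star_eq_adjoint, ContinuousLinearMap.adjoint_adjoint, hAv, eφ]
  rw [hB'] at hB
  have h2 := SMulMemClass.smul_mem (2⁻¹ : ℂ) hB
  convert h2 using 1
  rw [map_smulₛₗ, smul_smul, map_ofNat, inv_mul_cancel₀ two_ne_zero, one_smul]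

theorem rankOne_mem_wienerHopf (ξ η : L2R) : InnerProductSpace.rankOne ℂ ξ η ∈ wienerHopf := by
  refine dense_hasCompactSupport.induction
    (P := fun ξ => InnerProductSpace.rankOne ℂ ξ η ∈ wienerHopf) ?_
    (isClosed_wienerHopf.preimage (f := fun ξ => InnerProductSpace.rankOne ℂ ξ η) (by fun_prop)) ξ
  rintro ξ ⟨φ, hξ, hφ, hφc⟩
  refine dense_hasCompactSupport.induction
    (P := fun η => InnerProductSpace.rankOne ℂ ξ η ∈ wienerHopf) ?_
    (isClosed_wienerHopf.preimage (f := fun η => InnerProductSpace.rankOne ℂ ξ η) (by fun_prop)) η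
  rintro η ⟨θ, hη, hθ, hθc⟩
  exact rankOne_mem_of_compactSupport hφc.continuous hθc.continuous hφ hθ hξ hη

theorem mem_wienerHopf_of_isCompactOperator {T : L2R →L[ℂ] L2R} (hT : IsCompactOperator T) :
    T ∈ wienerHopf :=
  hT.induction (p := fun T => T ∈ wienerHopf) isClosed_wienerHopf rankOne_mem_wienerHopf
    (zero_mem _) (fun _ _ => add_mem) fun c _ => SMulMemClass.smul_mem c

theorem chi_mul_convRep_mem (g : Lp ℂ 1 (volume : Measure ℝ)) :
    mulOp chi * convRep g ∈ wienerHopf := by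
  obtain ⟨F, hF⟩ := exists_extension continuous_chi (R := 1) zero_le_one
    (fun x hx => chi_of_nonpos (by linarith)) fun x hx => by
      rw [chi_of_one_le hx, chi_of_one_le le_rfl]
  have := mulRep_mul_mem F (convRep_mem g)
  rwa [mulRep_eq_mulOp, funext hF] at this

theorem convRep_indL1_ne_zero : convRep (indL1 1) ≠ 0 := by
  intro h
  have h1 := ind_mul_convRep_indL1_mul_ind (R := 1 / 2) (L := 1) (by norm_num)
  rw [h, mul_zero, zero_mul] at h1
  have h2 : indL2 (1 / 2) = 0 := by simpa using h1.symm
  have h3 := inner_indL2 (1 / 2) (indL2 (1 / 2))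
  rw [h2, inner_zero_left, ← h2] at h3
  have h4 : ∫ x, ind (1 / 2) x * indL2 (1 / 2) x = ∫ x, ind (1 / 2) x := by
    refine integral_congr_ae ?_
    filter_upwards [(memLp_ind 2 (1 / 2)).coeFn_toLp] with x hx
    rw [indL2, hx]
    rcases le_or_gt |x| (1 / 2) with hx | hx
    · rw [ind_of_le hx, mul_one]
    · rw [ind_of_lt hx, mul_zero]
  rw [h4, integral_ind (by norm_num)] at h3
  norm_num at h3

/-- If χG were compact, the operator 0 would have symbol G, forcing G = 0. -/
theorem exists_mem_wienerHopf_not_isCompactOperator :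
    ∃ T ∈ wienerHopf, ¬ IsCompactOperator T := by
  refine ⟨mulOp chi * convRep (indL1 1), chi_mul_convRep_mem _, fun h => ?_⟩
  have h1 : IsCompactOperator ((0 : L2R →L[ℂ] L2R) - mulOp chi * convRep (indL1 1)) :=
    isCompactOperator_zero.sub h
  have h2 := norm_le_of_isCompactOperator_sub bdd_chi tendsto_chi (convRep_mul_trOp _) h1
  rw [norm_zero, norm_le_zero_iff] at h2
  exact convRep_indL1_ne_zero h2

/-! ### Conjugation by the unitary of a diffeomorphism -/

theorem conj_mulOp (u : DiffeoR) (hu : OrientationPreserving u) {f : ℝ → ℂ} (hf : Bdd f) :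
    (diffeoUnitary u hu).conjStarAlgEquiv (mulOp fun x => f (u.symm x)) = mulOp f := by
  have hb : Bdd fun x => f (u.symm x) := hf.comp u.symm.continuous.measurable
  ext1 ξ
  rw [LinearIsometryEquiv.conjStarAlgEquiv_apply_apply]
  obtain ⟨η, rfl⟩ := (diffeoUnitary u hu).surjective ξ
  rw [LinearIsometryEquiv.symm_apply_apply]
  refine Lp.ext ?_
  filter_upwards [diffeoUnitary_coeFn u hu (mulOp (fun x => f (u.symm x)) η),
    (quasiMeasurePreserving hu).ae (mulOp_coeFn hb η), mulOp_coeFn hf (diffeoUnitary u hu η),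
    diffeoUnitary_coeFn u hu η] with x h1 h2 h3 h4
  rw [h1, h2, h3, h4, u.symm_apply_apply]
  ring

theorem _root_.IsCompactOperator.conjStarAlgEquiv {T : L2R →L[ℂ] L2R} (hT : IsCompactOperator T)
    (U : L2R ≃ₗᵢ[ℂ] L2R) : IsCompactOperator (U.conjStarAlgEquiv T) :=
  (hT.clm_comp (U : L2R →L[ℂ] L2R)).comp_clm (U.symm : L2R →L[ℂ] L2R)

theorem norm_ch_sub_le (s x y : ℝ) : ‖ch s x - ch s y‖ ≤ 2 * Real.pi * |s| * |x - y| := by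
  have h1 : ch s x - ch s y = ch s y * (ch s (x - y) - 1) := by
    rw [mul_sub, ← ch_add, add_sub_cancel, mul_one]
  have h2 : ch s (x - y) = Complex.exp (Complex.I * ((2 * Real.pi * (s * (x - y)) : ℝ) : ℂ)) := by
    rw [ch, Real.fourierChar_apply, mul_comm Complex.I]
  rw [h1, norm_mul, norm_ch, one_mul, h2]
  refine (Real.norm_exp_I_mul_ofReal_sub_one_le).trans (le_of_eq ?_)
  rw [Real.norm_eq_abs, abs_mul, abs_mul, abs_mul, abs_two, abs_of_pos Real.pi_pos]
  ring

theorem slowlyVarying_ch_symm (u : DiffeoR) (hu : OrientationPreserving u)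
    (hlim : Tendsto (deriv u) atTop atTop) (s : ℝ) : SlowlyVarying fun x => ch s (u.symm x) := by
  have hmono : StrictMono u := strictMono_of_deriv_pos hu
  intro r ε hε
  obtain ⟨δ, hδ0, hδ⟩ : ∃ δ > 0, 2 * Real.pi * |s| * (δ * |r|) ≤ ε := by
    refine ⟨ε / (2 * Real.pi * |s| * |r| + 1), by have := Real.pi_pos; positivity, ?_⟩
    have := Real.pi_pos
    have h0 : 0 ≤ 2 * Real.pi * |s| * |r| := by positivity
    rw [show 2 * Real.pi * |s| * (ε / (2 * Real.pi * |s| * |r| + 1) * |r|) =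
      ε * (2 * Real.pi * |s| * |r|) / (2 * Real.pi * |s| * |r| + 1) by ring,
      div_le_iff₀ (by positivity)]
    nlinarith
  obtain ⟨N, hN⟩ := eventually_atTop.mp (hlim.eventually_ge_atTop δ⁻¹)
  -- Then x and x - t both lie in [u N, ∞), where the derivative of the inverse is at most δ.
  refine ⟨u N + |r|, fun x hx t ht => ?_⟩
  have htr := ht.trans (le_abs_self r)
  have hmv : ‖u.symm x - u.symm (x - t)‖ ≤ δ * ‖x - (x - t)‖ := by
    refine (convex_Ici (u N)).norm_image_sub_le_of_norm_deriv_le (𝕜 := ℝ)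
      (fun y _ => (hasDerivAt u.symm y).differentiableAt) (fun y hy => ?_) ?_ ?_
    · have h1 := deriv_mul_deriv_symm u (u.symm y)
      rw [u.apply_symm_apply] at h1
      have h2 : N ≤ u.symm y := by
        rw [← hmono.le_iff_le, u.apply_symm_apply]
        exact hy
      have h3 := hN _ h2
      have h4 := hu (u.symm y)
      rw [eq_inv_of_mul_eq_one_right h1, norm_inv, Real.norm_of_nonneg h4.le]
      exact inv_le_of_inv_le₀ hδ0 h3
    · have := le_abs_self t
      exact Set.mem_Ici.mpr (by linarith)
    · have := abs_nonneg r
      exact Set.mem_Ici.mpr (by linarith)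
  rw [sub_sub_cancel, Real.norm_eq_abs, Real.norm_eq_abs] at hmv
  refine (norm_ch_sub_le s _ _).trans (le_trans ?_ hδ)
  have := Real.pi_pos
  gcongr
  exact hmv.trans (by gcongr)

/-- Replace S by χH modulo compacts; M(ψ) commutes with χ, so only χ[M(ψ), H] is left. -/
theorem isCompactOperator_commutator_of_mem {ψ : ℝ → ℂ} (hψ : Bdd ψ) (hs : SlowlyVarying ψ)
    {S : L2R →L[ℂ] L2R} (hS : S ∈ wienerHopf) :
    IsCompactOperator (mulOp ψ * S - S * mulOp ψ) := by
  obtain ⟨H, hH, hc⟩ := wienerHopf_le_asymptoticConv hS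
  have e : mulOp ψ * S - S * mulOp ψ = mulOp ψ * (S - mulOp chi * H) -
      (S - mulOp chi * H) * mulOp ψ + mulOp chi * (mulOp ψ * H - H * mulOp ψ) := by
    have h1 : mulOp ψ * (mulOp chi * H) = mulOp chi * (mulOp ψ * H) := by
      rw [← mul_assoc, mulOp_comm hψ bdd_chi, mul_assoc]
    rw [mul_sub, h1]
    noncomm_ring
  rw [e]
  exact ((hc.mul_left _).sub (hc.mul_right _)).add (isCompactOperator_chi_commutator hψ hs hH)

theorem isCompactOperator_of_mem_inf (u : DiffeoR) (hu : OrientationPreserving u)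
    (hlim : Tendsto (deriv u) atTop atTop) {T : L2R →L[ℂ] L2R} (hT : T ∈ wienerHopf)
    (hT' : T ∈ adImage (diffeoUnitary u hu) wienerHopf) : IsCompactOperator T := by
  obtain ⟨G, hG, hc⟩ := wienerHopf_le_asymptoticConv hT
  obtain ⟨S, hS, rfl⟩ := hT'
  set T := (diffeoUnitary u hu).conjStarAlgEquiv S with hTdef
  change IsCompactOperator (T - mulOp chi * G) at hc
  change IsCompactOperator T
  have hcomm : ∀ s, IsCompactOperator (mulOp (ch s) * T - T * mulOp (ch s)) := fun s => by
    have h := (isCompactOperator_commutator_of_mem ((bdd_ch s).comp u.symm.continuous.measurable)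
      (slowlyVarying_ch_symm u hu hlim s) hS).conjStarAlgEquiv (diffeoUnitary u hu)
    rwa [map_sub, map_mul, map_mul, conj_mulOp u hu (bdd_ch s)] at h
  -- T agrees with its conjugate by the character modulo compacts, so both operators are symbols of
  -- T; the norm inequality applied to 0 makes them equal.
  have hinv : ∀ s, mulOp (ch s) * G * mulOp (ch (-s)) = G := fun s => by
    set e := mulOp (ch s)
    set e' := mulOp (ch (-s))
    have hee : e * e' = 1 := mulOp_ch_mul_neg s
    have hce : mulOp chi * e = e * mulOp chi := mulOp_comm bdd_chi (bdd_ch s)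
    have h1 : (0 : L2R →L[ℂ] L2R) - mulOp chi * (e * G * e' - G) =
        e * (T - mulOp chi * G) * e' - (T - mulOp chi * G) - (e * T - T * e) * e' := by
      have h2 : mulOp chi * (e * G * e') = e * (mulOp chi * G) * e' := by
        simp only [← mul_assoc]
        rw [hce]
      have h3 : T * e * e' = T := by rw [mul_assoc, hee, mul_one]
      rw [mul_sub, h2, sub_mul (e * T), h3]
      noncomm_ring
    have h4 : IsCompactOperator ((0 : L2R →L[ℂ] L2R) - mulOp chi * (e * G * e' - G)) := by
      rw [h1]
      exact (((hc.mul_left e).mul_right e').sub hc).sub ((hcomm s).mul_right e')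
    have h5 := norm_le_of_isCompactOperator_sub bdd_chi tendsto_chi
      (mul_trOp_of_mem (sub_mem (modulate_mem s hG) hG)) h4
    rw [norm_zero, norm_le_zero_iff] at h5
    exact sub_eq_zero.mp h5
  have hG0 : G = 0 := by
    -- By invariance the modulated vectors are constantly Gξ, yet they tend to 0.
    ext1 ξ
    refine tendsto_nhds_unique (f := fun _ : ℝ => G ξ) (l := atTop) tendsto_const_nhds
      ((tendsto_modulate_apply hG ξ).congr fun s => ?_)
    rw [hinv s]
  rwa [hG0, mul_zero, sub_zero] at hc

theorem mem_adImage_of_isCompactOperator (U : L2R ≃ₗᵢ[ℂ] L2R) {T : L2R →L[ℂ] L2R}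
    (hT : IsCompactOperator T) : T ∈ adImage U wienerHopf :=
  ⟨U.symm.conjStarAlgEquiv T, mem_wienerHopf_of_isCompactOperator (hT.conjStarAlgEquiv U.symm),
    U.conjStarAlgEquiv.apply_symm_apply T⟩

end WienerHopf

end

/-! ### Non-invariance and the intersection -/

theorem mainTheorem8 (u : WienerHopf.DiffeoR) (hu : WienerHopf.OrientationPreserving u)
    (hlim : Filter.Tendsto (deriv u) Filter.atTop Filter.atTop) :
    ¬ WienerHopf.adImage (WienerHopf.diffeoUnitary u hu) WienerHopf.wienerHopf
        ≤ WienerHopf.wienerHopf ∧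
    ((WienerHopf.wienerHopf ⊓
        WienerHopf.adImage (WienerHopf.diffeoUnitary u hu) WienerHopf.wienerHopf :
      NonUnitalStarSubalgebra ℂ (WienerHopf.L2R →L[ℂ] WienerHopf.L2R)) :
        Set (WienerHopf.L2R →L[ℂ] WienerHopf.L2R)) =
      {T : WienerHopf.L2R →L[ℂ] WienerHopf.L2R | IsCompactOperator T} := by
  refine ⟨fun hle => ?_, Set.Subset.antisymm ?_ ?_⟩
  -- Under the inclusion, Ad_U(S) would lie in the intersection and be compact, and so would S,
  -- conjugating back.
  · obtain ⟨S, hS, hnc⟩ := WienerHopf.exists_mem_wienerHopf_not_isCompactOperator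
    have hmem : (WienerHopf.diffeoUnitary u hu).conjStarAlgEquiv S ∈
        WienerHopf.adImage (WienerHopf.diffeoUnitary u hu) WienerHopf.wienerHopf := ⟨S, hS, rfl⟩
    have h := (WienerHopf.isCompactOperator_of_mem_inf u hu hlim (hle hmem)
      hmem).conjStarAlgEquiv (WienerHopf.diffeoUnitary u hu).symm
    have e : (WienerHopf.diffeoUnitary u hu).symm.conjStarAlgEquiv
        ((WienerHopf.diffeoUnitary u hu).conjStarAlgEquiv S) = S :=
      (WienerHopf.diffeoUnitary u hu).conjStarAlgEquiv.symm_apply_apply S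
    rw [e] at h
    exact hnc h
  · rintro T ⟨hT, hT'⟩
    exact WienerHopf.isCompactOperator_of_mem_inf u hu hlim hT hT'
  · intro T hT
    exact ⟨WienerHopf.mem_wienerHopf_of_isCompactOperator hT,
      WienerHopf.mem_adImage_of_isCompactOperator _ hT⟩
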